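/- For a permutation $\sigma$ of $\{1,\dots,n\}$, let $L(\sigma)$ denote the length of a longest increasing subsequence of $\sigma$, that is, the largest $k$ for which there are indices $1 \le i_1 < i_2 < \cdots < i_k \le n$ with $\sigma(i_1) < \sigma(i_2) < \cdots < \sigma(i_k)$. Let $\sigma_n$ be uniformly distributed on the symmetric group $S_n$, so that $$\mathbb{E}[L(\sigma_n)] = \frac{1}{n!} \sum_{\sigma \in S_n} L(\sigma).$$ Then $$\lim_{n \to \infty} \frac{\mathbb{E}[L(\sigma_n)]}{\sqrt{n}} = 2.$$ -/

import Mathlib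

/-- `L(σ)`: the largest number of indices in a set of positions along which the sequence
`σ 0, σ 1, …, σ (n - 1)` is strictly increasing. -/
def lisLength {n : ℕ} (σ : Equiv.Perm (Fin n)) : ℕ :=
  (Finset.univ.filter fun s : Finset (Fin n) =>
    ∀ i ∈ s, ∀ j ∈ s, i < j → σ i < σ j).sup Finset.card

/-- `E[L(σ_n)]` for `σ_n` uniformly distributed on the symmetric group of degree `n`. -/
noncomputable def expectedLIS (n : ℕ) : ℝ :=
  (1 / (n.factorial : ℝ)) * ∑ σ : Equiv.Perm (Fin n), (lisLength σ : ℝ)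

/-! Permutations are replaced by sparse random point sets: each cell of a grid is occupied
independently with probability `p`, and `chainLength` is the longest strictly increasing chain.

Upper bound. Adding independent points on the axes, with densities `a` and `b` satisfying `a * b =
(1 - a) * (1 - b) * p`, makes the last passage function stationary: its increments along down-right
paths keep their product law (`subsetExp_row`). Its mean over an `N × M` box is therefore exactly `a
* N + b * M`. It dominates the chain length, and optimising over `a`, `b` gives at most `2 * √(p * N
* M)`.

Lower bound. An optimal stationary path follows one axis up to an exit point and then is a chain in
the remaining box. If the mean chain length were at most `(2 - δ) * r * N` with `p = r ^ 2`, then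
every exit point would give a mean noticeably below `2 * r * N`: early exits by this assumption,
late ones by the upper bound for the smaller box (`add_min_sqrt_le`). An Efron–Stein bound, variance
at most mean, makes this uniform over a bounded number of blocks of exit points, contradicting the
exact stationary mean (`stationary_mean_le`).

Transfer. In a grid of side `n ^ 3` with about `n` points, two points rarely share a row or column.
Given that none do, permuting the columns shows that the points form a uniform permutation
(`subsetExp_nonAttacking`). Monotonicity of `expectedLIS` and concentration of the number of points
then pass both bounds to degree `n`. -/

open Finset

/-! ### Product measures on subsets and concentration -/

/-- Expectation of `f` over the random subset of `T` that contains each `x ∈ T` independently with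
probability `q x`. -/
noncomputable def subsetExp {α : Type*} [DecidableEq α] (q : α → ℝ) (T : Finset α)
    (f : Finset α → ℝ) : ℝ :=
  ∑ S ∈ T.powerset, ((∏ x ∈ S, q x) * ∏ x ∈ T \ S, (1 - q x)) * f S

namespace subsetExp

variable {α β : Type*} [DecidableEq α] [DecidableEq β] {q : α → ℝ} {T : Finset α}
  {f g : Finset α → ℝ}

@[simp] lemma empty (q : α → ℝ) (f : Finset α → ℝ) : subsetExp q ∅ f = f ∅ := by
  simp [subsetExp]

lemma insert {x : α} (hx : x ∉ T) (q : α → ℝ) (f : Finset α → ℝ) :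
    subsetExp q (insert x T) f =
      q x * subsetExp q T (fun S => f (insert x S)) + (1 - q x) * subsetExp q T f := by
  unfold subsetExp
  rw [sum_powerset_insert hx, add_comm, mul_sum, mul_sum]
  congr 1 <;> refine sum_congr rfl fun S hS => ?_
  · have hxS : x ∉ S := fun h => hx (mem_powerset.1 hS h)
    rw [prod_insert hxS, insert_sdiff_insert, sdiff_eq_sdiff_iff_inf_eq_inf.2]
    · ring
    · ext y; simp only [inf_eq_inter, mem_inter, mem_insert]; grind
  · have hxS : x ∉ S := fun h => hx (mem_powerset.1 hS h)
    rw [insert_sdiff_of_notMem _ hxS, prod_insert (by simp [hx])]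
    ring

lemma congr (h : ∀ S ⊆ T, f S = g S) : subsetExp q T f = subsetExp q T g :=
  sum_congr rfl fun S hS => by rw [h S (mem_powerset.1 hS)]

lemma add (q : α → ℝ) (T : Finset α) (f g : Finset α → ℝ) :
    subsetExp q T (fun S => f S + g S) = subsetExp q T f + subsetExp q T g := by
  simp [subsetExp, mul_add, sum_add_distrib]

lemma const_mul (q : α → ℝ) (T : Finset α) (c : ℝ) (f : Finset α → ℝ) :
    subsetExp q T (fun S => c * f S) = c * subsetExp q T f := by
  simp only [subsetExp, mul_sum]
  exact sum_congr rfl fun _ _ => by ring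

lemma sub (q : α → ℝ) (T : Finset α) (f g : Finset α → ℝ) :
    subsetExp q T (fun S => f S - g S) = subsetExp q T f - subsetExp q T g := by
  simp [subsetExp, mul_sub, sum_sub_distrib]

lemma sum {ι : Type*} (q : α → ℝ) (T : Finset α) (s : Finset ι) (F : ι → Finset α → ℝ) :
    subsetExp q T (fun S => ∑ i ∈ s, F i S) = ∑ i ∈ s, subsetExp q T (F i) := by
  simp only [subsetExp, mul_sum]
  exact sum_comm

@[simp] lemma const (q : α → ℝ) (T : Finset α) (c : ℝ) : subsetExp q T (fun _ => c) = c := by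
  induction T using Finset.induction with
  | empty => simp
  | insert x T hx ih => rw [insert hx, ih]; ring

lemma mono (hq : ∀ x ∈ T, 0 ≤ q x ∧ q x ≤ 1) (h : ∀ S ⊆ T, f S ≤ g S) :
    subsetExp q T f ≤ subsetExp q T g := by
  refine sum_le_sum fun S hS => mul_le_mul_of_nonneg_left (h S (mem_powerset.1 hS)) ?_
  refine mul_nonneg (prod_nonneg fun x hx => (hq x (mem_powerset.1 hS hx)).1)
    (prod_nonneg fun x hx => sub_nonneg.2 (hq x (mem_sdiff.1 hx).1).2)

lemma nonneg (hq : ∀ x ∈ T, 0 ≤ q x ∧ q x ≤ 1) (h : ∀ S ⊆ T, 0 ≤ f S) :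
    0 ≤ subsetExp q T f := by
  simpa using mono (f := fun _ => 0) hq h

lemma congr_prob {q' : α → ℝ} (h : ∀ x ∈ T, q x = q' x) : subsetExp q T f = subsetExp q' T f := by
  refine sum_congr rfl fun S hS => ?_
  rw [prod_congr rfl fun x hx => h x (mem_powerset.1 hS hx),
    prod_congr rfl fun x hx => congrArg (1 - ·) (h x (mem_sdiff.1 hx).1)]

/-- The coordinates outside `B` sum out, so the trace on `B` is again a product measure. -/
lemma inter (q : α → ℝ) (T B : Finset α) (f : Finset α → ℝ) :
    subsetExp q T (fun S => f (S ∩ B)) = subsetExp q (T ∩ B) f := by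
  induction T using Finset.induction generalizing f with
  | empty => simp
  | insert x T hx ih =>
    rw [insert hx, ih]
    by_cases hB : x ∈ B
    · have : x ∉ T ∩ B := by simp [hx]
      simp only [insert_inter_of_mem hB]
      rw [insert this, ih (fun S => f (Insert.insert x S))]
    · simp only [insert_inter_of_notMem hB]
      rw [ih]; ring

lemma map (e : α ↪ β) (q : β → ℝ) (T : Finset α) (f : Finset β → ℝ) :
    subsetExp q (T.map e) f = subsetExp (fun x => q (e x)) T (fun S => f (S.map e)) := by
  induction T using Finset.induction generalizing f with
  | empty => simp
  | insert x T hx ih =>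
    rw [map_insert, insert (by simpa using hx), insert hx, ih, ih]
    simp

lemma mem {x : α} (hx : x ∈ T) (q : α → ℝ) :
    subsetExp q T (fun S => if x ∈ S then 1 else 0) = q x := by
  have h : subsetExp q (Insert.insert x (T.erase x)) (fun S => if x ∈ S then (1 : ℝ) else 0) = q x := by
    rw [insert (notMem_erase x T)]
    have : subsetExp q (T.erase x) (fun S => if x ∈ S then (1 : ℝ) else 0)
        = subsetExp q (T.erase x) (fun _ => 0) :=
      congr fun S hS => if_neg fun h => notMem_erase x T (hS h)
    simp [this]
  rwa [insert_erase hx] at h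

lemma mem_mem {x y : α} (hx : x ∈ T) (hy : y ∈ T) (hxy : x ≠ y) (q : α → ℝ) :
    subsetExp q T (fun S => if x ∈ S ∧ y ∈ S then 1 else 0) = q x * q y := by
  have h : subsetExp q (Insert.insert x (T.erase x))
      (fun S => if x ∈ S ∧ y ∈ S then (1 : ℝ) else 0) = q x * q y := by
    rw [insert (notMem_erase x T)]
    have : subsetExp q (T.erase x) (fun S => if x ∈ S ∧ y ∈ S then (1 : ℝ) else 0)
        = subsetExp q (T.erase x) (fun _ => 0) :=
      congr fun S hS => if_neg fun h => notMem_erase x T (hS h.1)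
    rw [this]
    have : y ∈ T.erase x := mem_erase.2 ⟨hxy.symm, hy⟩
    simp [hxy.symm, mem this]
  rwa [insert_erase hx] at h

lemma card (q : α → ℝ) (T : Finset α) :
    subsetExp q T (fun S => (#S : ℝ)) = ∑ x ∈ T, q x := by
  have : subsetExp q T (fun S => (#S : ℝ))
      = subsetExp q T (fun S => ∑ x ∈ T, if x ∈ S then 1 else 0) :=
    congr fun S hS => by simp [inter_eq_right.2 hS]
  rw [this, sum]
  exact sum_congr rfl fun x hx => mem hx q

/-- Efron–Stein inequality for random subsets, in terms of deleted points. -/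
lemma variance_le (hq : ∀ x ∈ T, 0 ≤ q x ∧ q x ≤ 1) (f : Finset α → ℝ) :
    subsetExp q T (fun S => f S ^ 2) - subsetExp q T f ^ 2 ≤
      subsetExp q T (fun S => ∑ x ∈ S, (f S - f (S.erase x)) ^ 2) := by
  induction T using Finset.induction generalizing f with
  | empty => simp
  | insert x T hx ih =>
    have hqT : ∀ y ∈ T, 0 ≤ q y ∧ q y ≤ 1 := fun y hy => hq y (mem_insert_of_mem hy)
    obtain ⟨h0, h1⟩ := hq x (mem_insert_self x T)
    have i0 := ih hqT f
    have i1 := ih hqT (fun S => f (Insert.insert x S))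
    -- Jensen's inequality, from the nonnegativity of the variance of the difference.
    have hd : (subsetExp q T (fun S => f (Insert.insert x S)) - subsetExp q T f) ^ 2 ≤
        subsetExp q T (fun S => (f (Insert.insert x S) - f S) ^ 2) := by
      have := nonneg (q := q) (T := T) hqT
        (f := fun S => ((f (Insert.insert x S) - f S) -
          subsetExp q T (fun S => f (Insert.insert x S) - f S)) ^ 2) (fun S _ => sq_nonneg _)
      rw [← sub]
      set m := subsetExp q T (fun S => f (Insert.insert x S) - f S)
      have e : subsetExp q T (fun S => ((f (Insert.insert x S) - f S) - m) ^ 2)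
          = subsetExp q T (fun S => ((f (Insert.insert x S) - f S) ^ 2
            + (-2 * m) * (f (Insert.insert x S) - f S)) + m ^ 2) :=
        congr fun S _ => by ring
      rw [e, add, add, const_mul, const] at this
      change 0 ≤ _ + -2 * m * m + _ at this
      linarith
    rw [insert hx, insert hx, insert hx]
    have e : subsetExp q T (fun S => ∑ y ∈ Insert.insert x S,
          (f (Insert.insert x S) - f ((Insert.insert x S).erase y)) ^ 2)
        = subsetExp q T (fun S => (f (Insert.insert x S) - f S) ^ 2) +
          subsetExp q T (fun S => ∑ y ∈ S,
          (f (Insert.insert x S) - f (Insert.insert x (S.erase y))) ^ 2) := by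
      rw [← add]
      refine congr fun S hS => ?_
      have hxS : x ∉ S := fun h => hx (hS h)
      rw [sum_insert hxS, erase_insert hxS]
      congr 1
      refine sum_congr rfl fun y hy => ?_
      rw [erase_insert_of_ne (by rintro rfl; exact hxS hy)]
    rw [e]
    set A := subsetExp q T (fun S => f (Insert.insert x S))
    set B := subsetExp q T f
    -- Conditioning on `x` leaves a between-group term `q x * (1 - q x) * (A - B) ^ 2`; the last
    -- hint bounds its coefficient by `q x`.
    nlinarith [mul_le_mul_of_nonneg_left i1 h0, mul_le_mul_of_nonneg_left i0 (sub_nonneg.2 h1),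
      mul_le_mul_of_nonneg_left hd h0, mul_nonneg (mul_nonneg h0 h0) (sq_nonneg (A - B))]

/-- A functional is witnessed if `f S` is the cardinality of some subset `W` of `S` whose traces bound
`f` from below. -/
def _root_.Witnessed (f : Finset α → ℝ) : Prop :=
  (∀ R S, R ⊆ S → f R ≤ f S) ∧
    ∀ S, ∃ W ⊆ S, f S = #W ∧ ∀ R ⊆ S, (#(W ∩ R) : ℝ) ≤ f R

/-- Deleting a point changes `f S` by at most one, and only if the point lies in the witness `W`.
The Efron–Stein sum is thus at most `#W = f S`. -/
lemma variance_le_of_witnessed (hq : ∀ x ∈ T, 0 ≤ q x ∧ q x ≤ 1) (hf : Witnessed f) :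
    subsetExp q T (fun S => (f S - subsetExp q T f) ^ 2) ≤ subsetExp q T f := by
  set m := subsetExp q T f with hm
  have e : subsetExp q T (fun S => (f S - m) ^ 2)
      = subsetExp q T (fun S => (f S ^ 2 + (-2 * m) * f S) + m ^ 2) :=
    congr fun S _ => by ring
  rw [e, add, add, const_mul, const, ← hm]
  have h1 := variance_le hq f
  rw [← hm] at h1
  have h2 : subsetExp q T (fun S => ∑ x ∈ S, (f S - f (S.erase x)) ^ 2) ≤ m := by
    refine mono hq fun S _ => ?_
    obtain ⟨W, hW, hc, hR⟩ := hf.2 S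
    have : ∀ x ∈ S, (f S - f (S.erase x)) ^ 2 ≤ if x ∈ W then 1 else 0 := by
      intro x _
      have a1 := hf.1 _ _ (erase_subset x S)
      have a2 := hR _ (erase_subset x S)
      have a3 : W ∩ S.erase x = W.erase x := by
        ext y; simp only [mem_inter, mem_erase]; grind
      rw [a3] at a2
      split_ifs with hx
      · rw [card_erase_of_mem hx, Nat.cast_sub (card_pos.2 ⟨x, hx⟩)] at a2
        push_cast at a2
        rw [← hc] at a2
        nlinarith
      · rw [erase_eq_of_notMem hx, ← hc] at a2
        have : f S - f (S.erase x) = 0 := by linarith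
        simp [this]
    refine (sum_le_sum this).trans ?_
    rw [hc]
    simp [inter_eq_right.2 hW]
  linarith

lemma abs_sub_le (hq : ∀ x ∈ T, 0 ≤ q x ∧ q x ≤ 1) (hf : Witnessed f) {V : ℝ}
    (hV : 0 < V) (h : subsetExp q T f ≤ V) :
    subsetExp q T (fun S => |f S - subsetExp q T f|) ≤ √V := by
  have hv := variance_le_of_witnessed hq hf
  set m := subsetExp q T f
  have hs : 0 < √V := Real.sqrt_pos.2 hV
  have hss : √V * √V = V := Real.mul_self_sqrt hV.le
  have : subsetExp q T (fun S => |f S - m|) ≤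
      subsetExp q T (fun S => √V / 2 + (2 * √V)⁻¹ * (f S - m) ^ 2) := by
    refine mono hq fun S _ => ?_
    rw [← sq_abs (f S - m)]
    have : √V / 2 + (2 * √V)⁻¹ * |f S - m| ^ 2 - |f S - m| = (2 * √V)⁻¹ * (√V - |f S - m|) ^ 2 := by
      field_simp
      ring
    have h3 : 0 ≤ (2 * √V)⁻¹ * (√V - |f S - m|) ^ 2 := by positivity
    linarith
  refine this.trans ?_
  rw [add, const, const_mul]
  have h4 : (2 * √V)⁻¹ * subsetExp q T (fun S => (f S - m) ^ 2) ≤ (2 * √V)⁻¹ * V :=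
    mul_le_mul_of_nonneg_left (hv.trans h) (by positivity)
  have h5 : (2 * √V)⁻¹ * V = √V / 2 := by
    rw [eq_div_iff two_ne_zero]
    field_simp
    nlinarith
  linarith

end subsetExp

/-! ### Increasing chains in the plane -/

section Chains

variable {α β γ δ : Type*} [LinearOrder α] [LinearOrder β] [LinearOrder γ] [LinearOrder δ]

/-- A set of points in the plane is increasing if any two of them are strictly comparable in both
coordinates, in the same direction. -/
def IsIncreasing (C : Finset (α × β)) : Prop :=
  ∀ x ∈ C, ∀ y ∈ C, x ≠ y → (x.1 < y.1 ∧ x.2 < y.2) ∨ (y.1 < x.1 ∧ y.2 < x.2)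

open Classical in
/-- The largest cardinality of an increasing subset of `S`. -/
noncomputable def chainLength (S : Finset (α × β)) : ℕ :=
  (S.powerset.filter fun C => IsIncreasing C).sup card

lemma IsIncreasing.mono {C D : Finset (α × β)} (hD : IsIncreasing D) (h : C ⊆ D) :
    IsIncreasing C :=
  fun x hx y hy => hD x (h hx) y (h hy)

lemma IsIncreasing.card_le {C S : Finset (α × β)} (hC : IsIncreasing C) (h : C ⊆ S) :
    #C ≤ chainLength S :=
  le_sup (f := card) (by simp [hC, h])

lemma exists_isIncreasing (S : Finset (α × β)) :
    ∃ C ⊆ S, IsIncreasing C ∧ #C = chainLength S := by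
  classical
  obtain ⟨C, hC, h⟩ := exists_mem_eq_sup (S.powerset.filter fun C => IsIncreasing C)
    ⟨∅, by simp [IsIncreasing]⟩ card
  rw [mem_filter, mem_powerset] at hC
  exact ⟨C, hC.1, hC.2, by rw [chainLength, h]⟩

lemma chainLength_mono {R S : Finset (α × β)} (h : R ⊆ S) : chainLength R ≤ chainLength S := by
  obtain ⟨C, hC, hi, hc⟩ := exists_isIncreasing R
  exact hc ▸ hi.card_le (hC.trans h)

lemma chainLength_le_card (S : Finset (α × β)) : chainLength S ≤ #S := by
  obtain ⟨C, hC, _, hc⟩ := exists_isIncreasing S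
  exact hc ▸ card_le_card hC

lemma chainLength_map (e : α ↪o γ) (e' : β ↪o δ) (S : Finset (α × β)) :
    chainLength (S.map (e.toEmbedding.prodMap e'.toEmbedding)) = chainLength S := by
  apply le_antisymm
  · obtain ⟨C, hC, hi, hc⟩ := exists_isIncreasing (S.map (e.toEmbedding.prodMap e'.toEmbedding))
    obtain ⟨D, hD, rfl⟩ := subset_map_iff.1 hC
    rw [← hc, card_map]
    refine IsIncreasing.card_le (fun x hx y hy hxy => ?_) hD
    have := hi _ (mem_map_of_mem _ hx) _ (mem_map_of_mem _ hy)
      (fun h => hxy ((e.toEmbedding.prodMap e'.toEmbedding).injective h))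
    simpa using this
  · obtain ⟨C, hC, hi, hc⟩ := exists_isIncreasing S
    rw [← hc, ← card_map (e.toEmbedding.prodMap e'.toEmbedding)]
    refine IsIncreasing.card_le ?_ (map_subset_map.2 hC)
    intro x hx y hy hxy
    obtain ⟨x, hx', rfl⟩ := mem_map.1 hx
    obtain ⟨y, hy', rfl⟩ := mem_map.1 hy
    have := hi x hx' y hy' (by rintro rfl; exact hxy rfl)
    simpa using this

/-- This is the functional attached to one block of exit points: axis points in `A`, then a chain in
`B`. Disjointness lets one witness serve both terms. -/
lemma witnessed_card_add_chainLength {A B : Finset (α × β)} (h : Disjoint A B) :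
    Witnessed fun S => (#(S ∩ A) + chainLength (S ∩ B) : ℝ) := by
  constructor
  · intro R S hRS
    have h1 := card_le_card (inter_subset_inter_right hRS : R ∩ A ⊆ S ∩ A)
    have h2 := chainLength_mono (inter_subset_inter_right hRS : R ∩ B ⊆ S ∩ B)
    dsimp only
    exact_mod_cast add_le_add h1 h2
  · intro S
    obtain ⟨C, hC, hi, hc⟩ := exists_isIncreasing (S ∩ B)
    have hd : Disjoint (S ∩ A) C :=
      disjoint_of_subset_left inter_subset_right
        (disjoint_of_subset_right (hC.trans inter_subset_right) h)
    refine ⟨(S ∩ A) ∪ C, union_subset inter_subset_left (hC.trans inter_subset_left), ?_, ?_⟩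
    · rw [card_union_of_disjoint hd, hc]; push_cast; rfl
    · intro R hR
      have h1 : #(C ∩ R) ≤ chainLength (R ∩ B) :=
        (hi.mono inter_subset_left).card_le fun x hx => by
          rw [mem_inter] at hx ⊢
          exact ⟨hx.2, (mem_inter.1 (hC hx.1)).2⟩
      have h2 : #(((S ∩ A) ∪ C) ∩ R) ≤ #(R ∩ A) + #(C ∩ R) := by
        rw [union_inter_distrib_right]
        refine (card_union_le _ _).trans (Nat.add_le_add_right (card_le_card fun x => ?_) _)
        simp only [mem_inter]; tauto
      dsimp only
      exact_mod_cast h2.trans (Nat.add_le_add_left h1 _)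

lemma witnessed_chainLength : Witnessed fun S : Finset (α × β) => (chainLength S : ℝ) := by
  constructor
  · intro R S hRS
    dsimp only
    exact_mod_cast chainLength_mono hRS
  · intro S
    obtain ⟨C, hC, hi, hc⟩ := exists_isIncreasing S
    refine ⟨C, hC, by simp [hc], fun R _ => ?_⟩
    dsimp only
    exact_mod_cast (hi.mono inter_subset_left).card_le inter_subset_right

lemma witnessed_card {ι : Type*} [DecidableEq ι] : Witnessed fun S : Finset ι => (#S : ℝ) :=
  ⟨fun _ _ h => Nat.cast_le.2 <| card_le_card h, fun S => ⟨S, Subset.rfl, rfl, fun _ _ =>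
    Nat.cast_le.2 <| card_le_card inter_subset_right⟩⟩

end Chains

/-! ### Last passage with points on the axes -/

/-- Last passage function on the quadrant: points off the axes are collected along strictly
increasing steps, points on an axis while moving along that axis. -/
def lastPassage (S : Finset (ℕ × ℕ)) : ℕ → ℕ → ℕ
  | 0, 0 => 0
  | i + 1, 0 => lastPassage S i 0 + if (i + 1, 0) ∈ S then 1 else 0
  | 0, j + 1 => lastPassage S 0 j + if (0, j + 1) ∈ S then 1 else 0
  | i + 1, j + 1 => max (max (lastPassage S i (j + 1)) (lastPassage S (i + 1) j))
      (lastPassage S i j + if (i + 1, j + 1) ∈ S then 1 else 0)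
termination_by i j => i + j

section LastPassage

variable {S S' : Finset (ℕ × ℕ)}

lemma lastPassage_congr {i j : ℕ} (h : ∀ x ≤ i, ∀ y ≤ j, ((x, y) ∈ S ↔ (x, y) ∈ S')) :
    lastPassage S i j = lastPassage S' i j := by
  induction i, j using lastPassage.induct with
  | case1 => simp [lastPassage]
  | case2 i ih =>
    simp only [lastPassage, h (i + 1) le_rfl 0 le_rfl]
    rw [ih fun x hx y hy => h x (by omega) y hy]
  | case3 j ih =>
    simp only [lastPassage, h 0 le_rfl (j + 1) le_rfl]
    rw [ih fun x hx y hy => h x hx y (by omega)]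
  | case4 i j ih1 ih2 ih3 =>
    simp only [lastPassage, h (i + 1) le_rfl (j + 1) le_rfl]
    rw [ih1 fun x hx y hy => h x (by omega) y hy, ih2 fun x hx y hy => h x hx y (by omega),
      ih3 fun x hx y hy => h x (by omega) y (by omega)]

/-- Both directions are proved together by induction on the antidiagonal, since each bound at a new
vertex uses the horizontal and the vertical bound at the vertex diagonally before it. -/
lemma lastPassage_steps (S : Finset (ℕ × ℕ)) (n : ℕ) : ∀ i j, i + j = n →
    (lastPassage S i j ≤ lastPassage S (i + 1) j ∧
      lastPassage S (i + 1) j ≤ lastPassage S i j + 1) ∧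
    (lastPassage S i j ≤ lastPassage S i (j + 1) ∧
      lastPassage S i (j + 1) ≤ lastPassage S i j + 1) := by
  induction n with
  | zero =>
    intro i j h
    obtain ⟨rfl, rfl⟩ : i = 0 ∧ j = 0 := by omega
    simp only [lastPassage]
    split_ifs <;> simp
  | succ n ih =>
    intro i j h
    refine ⟨?_, ?_⟩
    · rcases j with _ | j
      · rw [lastPassage.eq_2]; split_ifs <;> simp
      · have h1 := ih i j (by omega)
        rw [lastPassage.eq_4]
        split_ifs <;> omega
    · rcases i with _ | i
      · rw [lastPassage.eq_3]; split_ifs <;> simp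
      · have h1 := ih i j (by omega)
        rw [lastPassage.eq_4]
        split_ifs <;> omega

lemma lastPassage_horizontal (S : Finset (ℕ × ℕ)) (i j : ℕ) :
    lastPassage S i j ≤ lastPassage S (i + 1) j ∧
      lastPassage S (i + 1) j ≤ lastPassage S i j + 1 :=
  (lastPassage_steps S _ i j rfl).1

lemma lastPassage_vertical (S : Finset (ℕ × ℕ)) (i j : ℕ) :
    lastPassage S i j ≤ lastPassage S i (j + 1) ∧
      lastPassage S i (j + 1) ≤ lastPassage S i j + 1 :=
  (lastPassage_steps S _ i j rfl).2

lemma IsIncreasing.card_le_lastPassage {C S : Finset (ℕ × ℕ)} (hi : IsIncreasing C) (hC : C ⊆ S)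
    {i j : ℕ} (hb : C ⊆ Ioc 0 i ×ˢ Ioc 0 j) : #C ≤ lastPassage S i j := by
  induction i, j using lastPassage.induct generalizing C with
  | case1 => simp_all
  | case2 i ih => simp_all
  | case3 j ih => simp_all
  | case4 i j ih1 ih2 ih3 =>
    rw [lastPassage]
    have hb' : ∀ x ∈ C, 0 < x.1 ∧ x.1 ≤ i + 1 ∧ 0 < x.2 ∧ x.2 ≤ j + 1 := fun x hx => by
      have := hb hx
      simp only [mem_product, mem_Ioc] at this
      tauto
    by_cases h : (i + 1, j + 1) ∈ C
    · rw [if_pos (hC h)]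
      refine le_max_of_le_right ?_
      rw [← card_erase_add_one h]
      refine Nat.add_le_add_right (ih3 (hi.mono (erase_subset _ _))
        ((erase_subset _ _).trans hC) fun x hx => ?_) _
      rw [mem_erase] at hx
      have h1 := hi x hx.2 _ h hx.1
      have h2 := hb' x hx.2
      simp only [mem_product, mem_Ioc]
      dsimp only at h1
      omega
    · refine le_max_of_le_left ?_
      -- A point of `C` in the last column dominates all others; as it is not the corner, `C` then
      -- misses the top row.
      by_cases h' : ∃ x ∈ C, x.1 = i + 1
      · obtain ⟨x, hx, hx1⟩ := h'
        refine le_max_of_le_right (ih2 hi hC fun y hy => ?_)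
        have h2 := hb' y hy
        have h3 := hb' x hx
        have h4 : x.2 ≠ j + 1 := fun h4 => h (by rw [← hx1, ← h4]; exact hx)
        simp only [mem_product, mem_Ioc]
        by_cases hxy : x = y
        · subst hxy; omega
        · have := hi x hx y hy hxy
          omega
      · push Not at h'
        refine le_max_of_le_left (ih1 hi hC fun y hy => ?_)
        have h2 := hb' y hy
        have := h' y hy
        simp only [mem_product, mem_Ioc]
        omega

lemma chainLength_le_lastPassage (S : Finset (ℕ × ℕ)) (i j : ℕ) :
    chainLength (S ∩ Ioc 0 i ×ˢ Ioc 0 j) ≤ lastPassage S i j := by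
  obtain ⟨C, hC, hi, hc⟩ := exists_isIncreasing (S ∩ Ioc 0 i ×ˢ Ioc 0 j)
  exact hc ▸ hi.card_le_lastPassage (hC.trans inter_subset_left) (hC.trans inter_subset_right)

lemma chainLength_inter_succ_le (S : Finset (ℕ × ℕ)) (x y i j : ℕ) (hx : x ≤ i) (hy : y ≤ j) :
    chainLength (S ∩ Ioc x i ×ˢ Ioc y j) + (if (i + 1, j + 1) ∈ S then 1 else 0) ≤
      chainLength (S ∩ Ioc x (i + 1) ×ˢ Ioc y (j + 1)) := by
  split_ifs with h
  · obtain ⟨C, hC, hi, hc⟩ := exists_isIncreasing (S ∩ Ioc x i ×ˢ Ioc y j)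
    have hb : ∀ z ∈ C, z ∈ S ∧ x < z.1 ∧ z.1 ≤ i ∧ y < z.2 ∧ z.2 ≤ j := fun z hz => by
      have := hC hz
      simp only [mem_inter, mem_product, mem_Ioc] at this
      tauto
    have hn : (i + 1, j + 1) ∉ C := fun h => by have := hb _ h; simp at this
    rw [← hc, ← card_insert_of_notMem hn]
    refine IsIncreasing.card_le ?_ ?_
    · intro u hu v hv huv
      rw [mem_insert] at hu hv
      rcases hu with rfl | hu <;> rcases hv with rfl | hv
      · exact absurd rfl huv
      · have := hb v hv; right; dsimp only; omega
      · have := hb u hu; left; dsimp only; omega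
      · exact hi u hu v hv huv
    · intro u hu
      rw [mem_insert] at hu
      simp only [mem_inter, mem_product, mem_Ioc]
      rcases hu with rfl | hu
      · exact ⟨h, by dsimp only; omega⟩
      · have := hb u hu
        exact ⟨this.1, by omega⟩
  · exact chainLength_mono (inter_subset_inter_left (product_subset_product
      (Ioc_subset_Ioc_right (by omega)) (Ioc_subset_Ioc_right (by omega))))

lemma lastPassage_zero_right (S : Finset (ℕ × ℕ)) (i : ℕ) :
    lastPassage S i 0 = #(S ∩ Ioc 0 i ×ˢ {0}) := by
  induction i with
  | zero => simp [lastPassage]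
  | succ i ih =>
    have : Ioc 0 (i + 1) ×ˢ {0} = insert (i + 1, 0) (Ioc 0 i ×ˢ {0}) := by
      ext ⟨x, y⟩; simp only [mem_product, mem_Ioc, mem_singleton, mem_insert, Prod.mk.injEq]; omega
    rw [lastPassage, ih, this]
    split_ifs with h
    · rw [inter_insert_of_mem h, card_insert_of_notMem (by simp)]
    · rw [inter_insert_of_notMem h, add_zero]

lemma lastPassage_zero_left (S : Finset (ℕ × ℕ)) (j : ℕ) :
    lastPassage S 0 j = #(S ∩ {0} ×ˢ Ioc 0 j) := by
  induction j with
  | zero => simp [lastPassage]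
  | succ j ih =>
    have : {0} ×ˢ Ioc 0 (j + 1) = insert (0, j + 1) ({0} ×ˢ Ioc 0 j) := by
      ext ⟨x, y⟩; simp only [mem_product, mem_Ioc, mem_singleton, mem_insert, Prod.mk.injEq]; omega
    rw [lastPassage, ih, this]
    split_ifs with h
    · rw [inter_insert_of_mem h, card_insert_of_notMem (by simp)]
    · rw [inter_insert_of_notMem h, add_zero]

/-- An optimal path leaves one of the axes at some point and then only collects points off the
axes. -/
lemma lastPassage_le_exit (S : Finset (ℕ × ℕ)) (i j : ℕ) :
    (∃ z ≤ i, lastPassage S i j ≤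
      #(S ∩ Ioc 0 z ×ˢ {0}) + chainLength (S ∩ Ioc z i ×ˢ Ioc 0 j)) ∨
    (∃ z ≤ j, lastPassage S i j ≤
      #(S ∩ {0} ×ˢ Ioc 0 z) + chainLength (S ∩ Ioc 0 i ×ˢ Ioc z j)) := by
  induction i, j using lastPassage.induct with
  | case1 => simp [lastPassage]
  | case2 i ih => exact Or.inl ⟨i + 1, le_rfl, (lastPassage_zero_right S _).le.trans (by simp)⟩
  | case3 j ih => exact Or.inr ⟨j + 1, le_rfl, (lastPassage_zero_left S _).le.trans (by simp)⟩
  | case4 i j ih1 ih2 ih3 => 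
    rw [lastPassage]
    rcases max_choice (max (lastPassage S i (j + 1)) (lastPassage S (i + 1) j))
      (lastPassage S i j + if (i + 1, j + 1) ∈ S then 1 else 0) with h | h
    · rw [h]
      rcases max_choice (lastPassage S i (j + 1)) (lastPassage S (i + 1) j) with h | h
      · rw [h]
        refine ih1.imp (fun ⟨z, hz, h⟩ => ⟨z, by omega, h.trans ?_⟩)
          (fun ⟨z, hz, h⟩ => ⟨z, by omega, h.trans ?_⟩) <;> gcongr <;>
        refine chainLength_mono (inter_subset_inter_left (product_subset_product ?_ ?_)) <;>
          exact Ioc_subset_Ioc_right (by omega)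
      · rw [h]
        refine ih2.imp (fun ⟨z, hz, h⟩ => ⟨z, by omega, h.trans ?_⟩)
          (fun ⟨z, hz, h⟩ => ⟨z, by omega, h.trans ?_⟩) <;> gcongr <;>
        refine chainLength_mono (inter_subset_inter_left (product_subset_product ?_ ?_)) <;>
          exact Ioc_subset_Ioc_right (by omega)
    · rw [h]
      refine ih3.imp (fun ⟨z, hz, h⟩ => ⟨z, by omega, ?_⟩)
          (fun ⟨z, hz, h⟩ => ⟨z, by omega, ?_⟩)
      · have := chainLength_inter_succ_le S z 0 i j hz (by omega)
        simp only [Nat.succ_eq_add_one]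
        omega
      · have := chainLength_inter_succ_le S 0 z i j (by omega) hz
        simp only [Nat.succ_eq_add_one]
        omega

end LastPassage

/-! ### Stationarity along down-right paths -/

/-- Horizontal unit increments of the last passage function along the down-right path that runs at
height `j + 1` over the first `i` columns and at height `j` over the others. -/
def pathIncrements (S : Finset (ℕ × ℕ)) (N i j : ℕ) : Finset ℕ :=
  (range N).filter fun k =>
    lastPassage S k (if k < i then j + 1 else j) < lastPassage S (k + 1) (if k < i then j + 1 else j)

/-- The vertical increment of the same path. -/
def pathJump (S : Finset (ℕ × ℕ)) (i j : ℕ) : Bool :=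
  decide (lastPassage S i j < lastPassage S i (j + 1))

/-- Effect on the increments of a down-right path of moving it across the cell in column `k`, where
`w` tells whether the cell is occupied. -/
def flipCell (k : ℕ) (w : Bool) (X : Finset ℕ) (J : Bool) : Finset ℕ × Bool :=
  if k ∈ X then (if J then (X.erase k, false) else (X, false))
  else if J then (X, true) else if w then (insert k X, true) else (X, false)

/-- Moving the path across a cell replaces the vertex `(i, j)` by `(i + 1, j + 1)`. The two old
increments there are 0 or 1, and together with `w` they determine the two new ones through the
recursion. -/
lemma flipCell_path {S S' : Finset (ℕ × ℕ)} {N i j : ℕ} (hi : i < N) {w : Bool}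
    (h : ∀ x y, ¬ (x = i + 1 ∧ y = j + 1) → ((x, y) ∈ S' ↔ (x, y) ∈ S))
    (hw : (i + 1, j + 1) ∈ S' ↔ w = true) :
    (pathIncrements S' N (i + 1) j, pathJump S' (i + 1) j) =
      flipCell i w (pathIncrements S N i j) (pathJump S i j) := by
  have hG : ∀ x y, ¬ (i + 1 ≤ x ∧ j + 1 ≤ y) → lastPassage S' x y = lastPassage S x y :=
    fun x y hxy => lastPassage_congr fun x' hx' y' hy' => h x' y' (by omega)
  have hnew : lastPassage S' (i + 1) (j + 1) =
      max (max (lastPassage S i (j + 1)) (lastPassage S (i + 1) j))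
        (lastPassage S i j + if w then 1 else 0) := by
    rw [lastPassage.eq_4, hG _ _ (by omega), hG _ _ (by omega), hG _ _ (by omega)]
    simp only [hw]
  have hne : ∀ k, k ≠ i → (k ∈ pathIncrements S' N (i + 1) j ↔ k ∈ pathIncrements S N i j) := by
    intro k hk
    simp only [pathIncrements, mem_filter]
    by_cases hki : k < i
    · rw [if_pos hki, if_pos (by omega), hG _ _ (by omega), hG _ _ (by omega)]
    · rw [if_neg hki, if_neg (by omega), hG _ _ (by omega), hG _ _ (by omega)]
  have hmem : i ∈ pathIncrements S N i j ↔ lastPassage S i j < lastPassage S (i + 1) j := by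
    simp [pathIncrements, hi]
  have hmem' : i ∈ pathIncrements S' N (i + 1) j ↔
      lastPassage S i (j + 1) < lastPassage S' (i + 1) (j + 1) := by
    simp [pathIncrements, hi, hG i (j + 1)]
  have hJ : pathJump S' (i + 1) j =
      decide (lastPassage S (i + 1) j < lastPassage S' (i + 1) (j + 1)) := by
    simp [pathJump, hG (i + 1) j]
  have b1 := lastPassage_horizontal S i j
  have b2 := lastPassage_vertical S i j
  rw [hnew] at hmem' hJ
  have hX : ∀ Y : Finset ℕ, (∀ k, k ≠ i → (k ∈ Y ↔ k ∈ pathIncrements S N i j)) →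
      (i ∈ Y ↔ i ∈ pathIncrements S' N (i + 1) j) → pathIncrements S' N (i + 1) j = Y := by
    intro Y h1 h2
    ext k
    by_cases hk : k = i
    · rw [hk, h2]
    · rw [hne k hk, h1 k hk]
  unfold flipCell
  by_cases c1 : i ∈ pathIncrements S N i j
  · rw [if_pos c1]
    have c1' := hmem.1 c1
    by_cases c2 : lastPassage S i j < lastPassage S i (j + 1)
    · rw [if_pos (by simpa [pathJump] using c2)]
      refine Prod.ext (hX _ (fun k hk => by simp [hk]) ?_) ?_
      · rw [hmem']; simp only [notMem_erase, false_iff]; split_ifs <;> omega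
      · rw [hJ]; simp only [decide_eq_false_iff_not]; split_ifs <;> omega
    · rw [if_neg (by simpa [pathJump] using c2)]
      refine Prod.ext (hX _ (fun k hk => Iff.rfl) ?_) ?_
      · rw [hmem']; simp only [c1, true_iff]; split_ifs <;> omega
      · rw [hJ]; simp only [decide_eq_false_iff_not]; split_ifs <;> omega
  · rw [if_neg c1]
    have c1' := mt hmem.2 c1
    by_cases c2 : lastPassage S i j < lastPassage S i (j + 1)
    · rw [if_pos (by simpa [pathJump] using c2)]
      refine Prod.ext (hX _ (fun k hk => Iff.rfl) ?_) ?_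
      · rw [hmem']; simp only [c1, false_iff]; split_ifs <;> omega
      · rw [hJ]; simp only [decide_eq_true_eq]; split_ifs <;> omega
    · rw [if_neg (by simpa [pathJump] using c2)]
      rcases w with _ | _
      · refine Prod.ext (hX _ (fun k hk => Iff.rfl) ?_) ?_
        · rw [hmem']; simp [c1]; omega
        · rw [hJ]; simp; omega
      · refine Prod.ext (hX _ (fun k hk => by simp [hk]) ?_) ?_
        · rw [hmem']; simp; omega
        · rw [hJ]; simp; omega

/-- Local invariance of product measures under `flipCell`. -/
lemma subsetExp_flipCell {a b p : ℝ} (h : a * b = (1 - a) * (1 - b) * p) {U : Finset ℕ} {k : ℕ}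
    (hk : k ∈ U) (F : Finset ℕ × Bool → ℝ) :
    subsetExp (fun _ => a) U (fun X =>
        b * (p * F (flipCell k true X true) + (1 - p) * F (flipCell k false X true)) +
        (1 - b) * (p * F (flipCell k true X false) + (1 - p) * F (flipCell k false X false))) =
      subsetExp (fun _ => a) U (fun X => b * F (X, true) + (1 - b) * F (X, false)) := by
  rw [← insert_erase hk, subsetExp.insert (notMem_erase k U), subsetExp.insert (notMem_erase k U),
    ← subsetExp.const_mul, ← subsetExp.const_mul, ← subsetExp.const_mul, ← subsetExp.const_mul,
    ← subsetExp.add, ← subsetExp.add]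
  refine subsetExp.congr fun X hX => ?_
  have hkX : k ∉ X := fun h => notMem_erase k U (hX h)
  simp only [flipCell, mem_insert_self, if_true, hkX, if_false, erase_insert hkX,
    Bool.false_eq_true]
  -- `flipCell` only moves "both increments" to "neither", with weight `a * b`, and "neither" to
  -- "both", with weight `(1 - a) * (1 - b) * p`; `h` balances the two flows.
  linear_combination (F (X, false) - F (insert k X, true)) * h

/-- Inclusion probabilities of the stationary model: `a` on the horizontal axis, `b` on the vertical
axis and `p` elsewhere. -/
noncomputable def stationaryProb (a b p : ℝ) (x : ℕ × ℕ) : ℝ :=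
  if x.2 = 0 then a else if x.1 = 0 then b else p

/-- The grid of height `j`, together with the first `i + 1` cells of the next row. -/
def partialGrid (N i j : ℕ) : Finset (ℕ × ℕ) :=
  range (N + 1) ×ˢ range (j + 1) ∪ range (i + 1) ×ˢ {j + 1}

lemma pathIncrements_of_le {S : Finset (ℕ × ℕ)} {N i j : ℕ} (hi : N ≤ i) :
    pathIncrements S N i j = pathIncrements S N 0 (j + 1) := by
  refine filter_congr fun k hk => ?_
  rw [if_pos (by rw [mem_range] at hk; omega), if_neg (by omega)]

/-- The next row is added cell by cell. Its axis point creates an independent jump of probability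
`b`, and each further cell is independent of the past and preserves the law by `subsetExp_flipCell`.
-/
lemma subsetExp_path_of_row {a b p : ℝ} (h : a * b = (1 - a) * (1 - b) * p) {N j : ℕ}
    (hrow : ∀ F : Finset ℕ → ℝ, subsetExp (stationaryProb a b p) (range (N + 1) ×ˢ range (j + 1))
      (fun S => F (pathIncrements S N 0 j)) = subsetExp (fun _ => a) (range N) F)
    {i : ℕ} (hi : i ≤ N) (F : Finset ℕ × Bool → ℝ) :
    subsetExp (stationaryProb a b p) (partialGrid N i j)
        (fun S => F (pathIncrements S N i j, pathJump S i j)) =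
      subsetExp (fun _ => a) (range N) (fun X => b * F (X, true) + (1 - b) * F (X, false)) := by
  induction i generalizing F with
  | zero =>
    have hn : (0, j + 1) ∉ range (N + 1) ×ˢ range (j + 1) := by simp
    have : partialGrid N 0 j = insert (0, j + 1) (range (N + 1) ×ˢ range (j + 1)) := by
      ext ⟨x, y⟩
      simp only [partialGrid, mem_union, mem_product, mem_range, mem_singleton, mem_insert,
        Prod.mk.injEq]
      omega
    rw [this, subsetExp.insert hn, ← hrow, ← subsetExp.const_mul, ← subsetExp.const_mul,
      ← subsetExp.add]
    refine subsetExp.congr fun S hS => ?_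
    have hq : stationaryProb a b p (0, j + 1) = b := by simp [stationaryProb]
    have hSn : (0, j + 1) ∉ S := fun h => hn (hS h)
    have hG : ∀ x y, y ≤ j → lastPassage (insert (0, j + 1) S) x y = lastPassage S x y :=
      fun x y hxy => lastPassage_congr fun x' hx' y' hy' => by
        simp only [mem_insert, Prod.mk.injEq]
        constructor
        · rintro (h | h)
          · omega
          · exact h
        · exact Or.inr
    have h1 : pathIncrements (insert (0, j + 1) S) N 0 j = pathIncrements S N 0 j := by
      refine filter_congr fun k hk => ?_
      rw [if_neg (by omega), hG _ _ le_rfl, hG _ _ le_rfl]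
    have h2 : pathJump (insert (0, j + 1) S) 0 j = true := by
      simp [pathJump, lastPassage.eq_3]
    have h3 : pathJump S 0 j = false := by
      simp [pathJump, lastPassage.eq_3, hSn]
    rw [hq, h1, h2, h3]
  | succ i ih =>
    have hn : (i + 1, j + 1) ∉ partialGrid N i j := by simp [partialGrid]
    have : partialGrid N (i + 1) j = insert (i + 1, j + 1) (partialGrid N i j) := by
      ext ⟨x, y⟩
      simp only [partialGrid, mem_union, mem_product, mem_range, mem_singleton, mem_insert,
        Prod.mk.injEq]
      omega
    have hq : stationaryProb a b p (i + 1, j + 1) = p := by simp [stationaryProb]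
    rw [this, subsetExp.insert hn, hq, ← subsetExp.const_mul, ← subsetExp.const_mul,
      ← subsetExp.add, ← subsetExp_flipCell h (mem_range.2 (show i < N by omega)) F]
    rw [← ih (by omega) (fun Y => p * F (flipCell i true Y.1 Y.2) +
      (1 - p) * F (flipCell i false Y.1 Y.2))]
    refine subsetExp.congr fun S hS => ?_
    have hSn : (i + 1, j + 1) ∉ S := fun h => hn (hS h)
    rw [flipCell_path (S := S) (by omega) (w := true)
      (fun x y hxy => by simp only [mem_insert, Prod.mk.injEq]; tauto) (by simp),
      flipCell_path (S := S) (by omega) (w := false) (fun x y hxy => Iff.rfl) (by simp [hSn])]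

/-- In row 0 the increments are the axis points themselves; sweeping the jump across all `N` columns
raises the path by one row. -/
lemma subsetExp_row {a b p : ℝ} (h : a * b = (1 - a) * (1 - b) * p) (N j : ℕ)
    (F : Finset ℕ → ℝ) :
    subsetExp (stationaryProb a b p) (range (N + 1) ×ˢ range (j + 1))
      (fun S => F (pathIncrements S N 0 j)) = subsetExp (fun _ => a) (range N) F := by
  induction j generalizing F with
  | zero =>
    obtain ⟨e, he⟩ : ∃ e : ℕ ↪ ℕ × ℕ, ∀ k, e k = (k + 1, 0) :=
      ⟨⟨fun k => (k + 1, 0), fun x y h => by simpa using h⟩, fun _ => rfl⟩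
    have hn : (0, 0) ∉ (range N).map e := by simp [he]
    have : range (N + 1) ×ˢ range (0 + 1) = insert (0, 0) ((range N).map e) := by
      ext ⟨x, y⟩
      simp only [mem_product, mem_range, mem_insert, Prod.mk.injEq, mem_map, he]
      constructor
      · rintro ⟨h1, h2⟩
        rcases x with _ | x
        · left; omega
        · right; exact ⟨x, by omega, rfl, by omega⟩
      · rintro (h | ⟨z, hz, h1, h2⟩) <;> omega
    have hpath : ∀ S : Finset (ℕ × ℕ), pathIncrements S N 0 0 =
        (range N).filter fun k => (k + 1, 0) ∈ S := by
      intro S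
      refine filter_congr fun k hk => ?_
      simp only [Nat.not_lt_zero, if_false, lastPassage]
      split_ifs with h <;> simp [h]
    have hmap : ∀ X ⊆ range N, (range N).filter (fun k => (k + 1, 0) ∈ X.map e) = X := by
      intro X hX
      ext k
      simp only [mem_filter, mem_map, he, Prod.mk.injEq, and_true,
        add_left_inj, exists_eq_right]
      exact ⟨fun h => h.2, fun h => ⟨hX h, h⟩⟩
    have hins : ∀ S : Finset (ℕ × ℕ), (range N).filter (fun k => (k + 1, 0) ∈ insert (0, 0) S)
        = (range N).filter (fun k => (k + 1, 0) ∈ S) := by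
      intro S; simp
    simp only [hpath]
    rw [this, subsetExp.insert hn]
    simp only [hins]
    rw [← add_mul, add_sub_cancel, one_mul, subsetExp.map,
      subsetExp.congr_prob (q' := fun _ => a) (by simp [stationaryProb, he])]
    exact subsetExp.congr fun X hX => by rw [hmap X hX]
  | succ j ih =>
    have h1 : range (N + 1) ×ˢ range (j + 1 + 1) = partialGrid N N j := by
      ext ⟨x, y⟩
      simp only [partialGrid, mem_union, mem_product, mem_range, mem_singleton]
      omega
    have h2 := subsetExp_path_of_row h ih le_rfl (fun Y => F Y.1)
    dsimp only at h2
    rw [h1]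
    simp only [← pathIncrements_of_le (le_refl N)]
    rw [h2]
    exact subsetExp.congr fun X _ => by ring

lemma lastPassage_eq_add_card (S : Finset (ℕ × ℕ)) (N j : ℕ) :
    lastPassage S N j = lastPassage S 0 j + #(pathIncrements S N 0 j) := by
  induction N with
  | zero => simp [pathIncrements]
  | succ N ih =>
    have := lastPassage_horizontal S N j
    simp only [pathIncrements, range_add_one, filter_insert, Nat.not_lt_zero, if_false] at ih ⊢
    split_ifs with h
    · rw [card_insert_of_notMem (by simp)]; omega
    · omega

/-- Mean of the last passage function in the stationary model. -/
lemma subsetExp_lastPassage {a b p : ℝ} (h : a * b = (1 - a) * (1 - b) * p) (N M : ℕ) :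
    subsetExp (stationaryProb a b p) (range (N + 1) ×ˢ range (M + 1))
      (fun S => (lastPassage S N M : ℝ)) = a * N + b * M := by
  -- The value at `(N, M)` is the number of points on the vertical axis plus the number of
  -- increments along row `M`; both have product laws.
  simp only [lastPassage_eq_add_card _ N M, lastPassage_zero_left, Nat.cast_add]
  rw [subsetExp.add, subsetExp_row h N M (fun X => (#X : ℝ)), subsetExp.card,
    subsetExp.inter (f := fun S => (#S : ℝ)), subsetExp.card]
  have : range (N + 1) ×ˢ range (M + 1) ∩ {0} ×ˢ Ioc 0 M = {0} ×ˢ Ioc 0 M := by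
    ext ⟨x, y⟩
    simp only [mem_inter, mem_product, mem_range, mem_singleton, mem_Ioc]
    omega
  rw [this, sum_congr rfl (g := fun _ => b)]
  · simp; ring
  · rintro ⟨x, y⟩ hx
    simp only [mem_product, mem_singleton, mem_Ioc] at hx
    simp [stationaryProb, hx.1, show y ≠ 0 by omega]

/-! ### Upper bound for chains in a box -/

section Box

lemma prob_mem_Icc {α : Type*} {T : Finset α} {p : ℝ} (h0 : 0 ≤ p) (h1 : p ≤ 1) :
    ∀ x ∈ T, 0 ≤ (fun _ : α => p) x ∧ (fun _ : α => p) x ≤ 1 := fun _ _ => ⟨h0, h1⟩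

lemma stationaryProb_mem_Icc {a b p : ℝ} (ha : 0 ≤ a ∧ a ≤ 1) (hb : 0 ≤ b ∧ b ≤ 1)
    (hp : 0 ≤ p ∧ p ≤ 1) (T : Finset (ℕ × ℕ)) :
    ∀ x ∈ T, 0 ≤ stationaryProb a b p x ∧ stationaryProb a b p x ≤ 1 := by
  intro x _
  unfold stationaryProb
  split_ifs <;> assumption

lemma subsetExp_stationary_inter_box {a b p : ℝ} {N M x i y j : ℕ} (hi : i ≤ N) (hj : j ≤ M)
    (f : Finset (ℕ × ℕ) → ℝ) :
    subsetExp (stationaryProb a b p) (range (N + 1) ×ˢ range (M + 1))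
      (fun S => f (S ∩ Ioc x i ×ˢ Ioc y j)) = subsetExp (fun _ => p) (Ioc x i ×ˢ Ioc y j) f := by
  rw [subsetExp.inter]
  have : range (N + 1) ×ˢ range (M + 1) ∩ Ioc x i ×ˢ Ioc y j = Ioc x i ×ˢ Ioc y j := by
    ext ⟨u, v⟩
    simp only [mem_inter, mem_product, mem_range, mem_Ioc]
    omega
  rw [this]
  refine subsetExp.congr_prob ?_
  rintro ⟨u, v⟩ h
  simp only [mem_product, mem_Ioc] at h
  simp [stationaryProb, show u ≠ 0 by omega, show v ≠ 0 by omega]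

lemma subsetExp_chainLength_le_linear {a b p : ℝ} (h : a * b = (1 - a) * (1 - b) * p)
    (ha : 0 ≤ a ∧ a ≤ 1) (hb : 0 ≤ b ∧ b ≤ 1) (hp : 0 ≤ p ∧ p ≤ 1) (N M : ℕ) :
    subsetExp (fun _ => p) (Ioc 0 N ×ˢ Ioc 0 M) (fun S => (chainLength S : ℝ)) ≤ a * N + b * M := by
  rw [← subsetExp_lastPassage h N M, ← subsetExp_stationary_inter_box (a := a) (b := b)
    (le_refl N) (le_refl M)]
  exact subsetExp.mono (stationaryProb_mem_Icc ha hb hp _)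
    fun S _ => Nat.cast_le.2 (chainLength_le_lastPassage S N M)

lemma odds_mem_Icc {t : ℝ} (ht : 0 ≤ t) : 0 ≤ t / (1 + t) ∧ t / (1 + t) ≤ 1 :=
  ⟨by positivity, (div_le_one (by positivity)).2 (by linarith)⟩

/-- In terms of the odds `s = a / (1 - a)` and `t = b / (1 - b)`, the stationarity relation is
simply `s * t = p`. -/
lemma odds_mul {s t : ℝ} (hs : 0 ≤ s) (ht : 0 ≤ t) :
    s / (1 + s) * (t / (1 + t)) = (1 - s / (1 + s)) * (1 - t / (1 + t)) * (s * t) := by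
  field_simp
  ring

lemma odds_le {t : ℝ} (ht : 0 ≤ t) : t / (1 + t) ≤ t :=
  div_le_self ht (by linarith)

lemma subsetExp_chainLength_le_sqrt_zero {p : ℝ} (hp : 0 ≤ p ∧ p ≤ 1) (N M : ℕ) :
    subsetExp (fun _ => p) (Ioc 0 N ×ˢ Ioc 0 M) (fun S => (chainLength S : ℝ)) ≤
      2 * √(p * N * M) := by
  -- In the degenerate cases there are almost surely no points, and the odds below may be
  -- meaningless.
  by_cases hdeg : N = 0 ∨ M = 0 ∨ p = 0
  · have : subsetExp (fun _ => p) (Ioc 0 N ×ˢ Ioc 0 M) (fun S => (chainLength S : ℝ)) ≤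
        subsetExp (fun _ => p) (Ioc 0 N ×ˢ Ioc 0 M) (fun S => (#S : ℝ)) :=
      subsetExp.mono (prob_mem_Icc hp.1 hp.2) fun S _ => Nat.cast_le.2 (chainLength_le_card S)
    rw [subsetExp.card] at this
    rcases hdeg with rfl | rfl | rfl <;> simpa using this
  · push Not at hdeg
    obtain ⟨hN, hM, hp0⟩ := hdeg
    have hN' : (0 : ℝ) < N := by positivity
    have hM' : (0 : ℝ) < M := by positivity
    have hp' : 0 < p := lt_of_le_of_ne hp.1 (Ne.symm hp0)
    set r := √(p * N * M) with hr
    have hr0 : 0 < r := Real.sqrt_pos.2 (by positivity)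
    have hrr : r * r = p * N * M := Real.mul_self_sqrt (by positivity)
    -- The odds `r / N` and `r / M` minimise `s * N + t * M` subject to `s * t = p`; the minimum is
    -- `2 * r`.
    have hs : 0 ≤ r / N := by positivity
    have ht : 0 ≤ r / M := by positivity
    have hst : r / N * (r / M) = p := by
      field_simp
      linarith
    have := subsetExp_chainLength_le_linear (hst ▸ odds_mul hs ht) (odds_mem_Icc hs)
      (odds_mem_Icc ht) hp N M
    have e1 := mul_le_mul_of_nonneg_right (odds_le hs) hN'.le
    have e2 := mul_le_mul_of_nonneg_right (odds_le ht) hM'.le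
    rw [div_mul_cancel₀ _ hN'.ne'] at e1
    rw [div_mul_cancel₀ _ hM'.ne'] at e2
    linarith

lemma subsetExp_chainLength_translate (p : ℝ) (x y N M : ℕ) :
    subsetExp (fun _ => p) (Ioc x (x + N) ×ˢ Ioc y (y + M)) (fun S => (chainLength S : ℝ)) =
      subsetExp (fun _ => p) (Ioc 0 N ×ˢ Ioc 0 M) (fun S => (chainLength S : ℝ)) := by
  have : Ioc x (x + N) ×ˢ Ioc y (y + M) = (Ioc 0 N ×ˢ Ioc 0 M).map
      ((OrderEmbedding.addLeft x).toEmbedding.prodMap (OrderEmbedding.addLeft y).toEmbedding) := by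
    ext ⟨u, v⟩
    simp only [mem_product, mem_Ioc, mem_map, Prod.exists]
    constructor
    · intro h
      refine ⟨u - x, v - y, by omega, ?_⟩
      simp only [Function.Embedding.coe_prodMap, Prod.map_apply, RelEmbedding.coe_toEmbedding,
        OrderEmbedding.addLeft_apply, Prod.mk.injEq]
      omega
    · rintro ⟨a, b, h, h'⟩
      simp only [Function.Embedding.coe_prodMap, Prod.map_apply, RelEmbedding.coe_toEmbedding,
        OrderEmbedding.addLeft_apply, Prod.mk.injEq] at h'
      omega
  rw [this, subsetExp.map]
  simp only [chainLength_map]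

/-- The mean length of a longest increasing chain of random lattice points in a rectangle is at most
twice the square root of the mean number of points. -/
lemma subsetExp_chainLength_le_sqrt {p : ℝ} (hp : 0 ≤ p ∧ p ≤ 1) (x i y j : ℕ) :
    subsetExp (fun _ => p) (Ioc x i ×ˢ Ioc y j) (fun S => (chainLength S : ℝ)) ≤
      2 * √(p * (i - x : ℕ) * (j - y : ℕ)) := by
  have : Ioc x i ×ˢ Ioc y j = Ioc x (x + (i - x)) ×ˢ Ioc y (y + (j - y)) := by
    ext ⟨u, v⟩; simp only [mem_product, mem_Ioc]; omega
  rw [this, subsetExp_chainLength_translate]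
  exact subsetExp_chainLength_le_sqrt_zero hp _ _

end Box

/-! ### Lower bound for chains in a sparse square -/

/-- A maximum of functionals with means at most `m` exceeds `m` by at most the sum of their
deviations, each of mean at most `√m`. This crude bound suffices because `#J` stays bounded while
`m` grows. -/
lemma subsetExp_le_of_exists_le {α ι : Type*} [DecidableEq α] {q : α → ℝ} {T : Finset α}
    (hq : ∀ x ∈ T, 0 ≤ q x ∧ q x ≤ 1) {J : Finset ι} {f : ι → Finset α → ℝ} {g : Finset α → ℝ}
    {m : ℝ} (hm : 0 < m) (hf : ∀ j ∈ J, Witnessed (f j)) (hfm : ∀ j ∈ J, subsetExp q T (f j) ≤ m)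
    (hg : ∀ S ⊆ T, ∃ j ∈ J, g S ≤ f j S) :
    subsetExp q T g ≤ m + #J * √m := by
  have h1 : subsetExp q T g ≤
      subsetExp q T (fun S => m + ∑ j ∈ J, |f j S - subsetExp q T (f j)|) := by
    refine subsetExp.mono hq fun S hS => ?_
    obtain ⟨j, hj, h⟩ := hg S hS
    have h2 := single_le_sum (f := fun j => |f j S - subsetExp q T (f j)|)
      (fun i _ => abs_nonneg _) hj
    have h3 := le_abs_self (f j S - subsetExp q T (f j))
    have h4 := hfm j hj
    linarith
  refine h1.trans ?_
  rw [subsetExp.add, subsetExp.const, subsetExp.sum, ← nsmul_eq_mul]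
  gcongr
  exact sum_le_card_nsmul _ _ _ fun j hj => subsetExp.abs_sub_le hq (hf j hj) hm (hfm j hj)

/-- Here `u` is the relative exit position. For `u ≤ δ / 2` the first entry of the minimum gains `δ
/ 2`; otherwise the second-order term of the square root gains `u ^ 2 / 4 ≥ δ ^ 2 / 16`. -/
lemma add_min_sqrt_le {u δ : ℝ} (hu0 : 0 ≤ u) (hu1 : u ≤ 1) (hδ0 : 0 < δ) (hδ1 : δ ≤ 1) :
    u + min (2 - δ) (2 * √(1 - u)) ≤ 2 - δ ^ 2 / 16 := by
  by_cases h : u ≤ δ / 2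
  · have := min_le_left (2 - δ) (2 * √(1 - u))
    nlinarith
  · push Not at h
    have h1 := min_le_right (2 - δ) (2 * √(1 - u))
    have h2 : √(1 - u) ≤ 1 - u / 2 - u ^ 2 / 8 := by
      rw [Real.sqrt_le_left (by nlinarith)]
      have : 0 ≤ u ^ 3 / 8 + u ^ 4 / 64 := by positivity
      nlinarith
    nlinarith

/-- Mean number of axis points plus mean chain length for a path with a prescribed approximate exit
point. -/
lemma exit_mean_le {r δ : ℝ} (hr0 : 0 < r) (hδ0 : 0 < δ) (hδ1 : δ ≤ 1) {N v w : ℕ}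
    (hN : 0 < N) (hv : v ≤ N) {c ℓ ℓ₀ : ℝ} (hc : c ≤ r * (v + w : ℕ)) (hℓ : ℓ ≤ ℓ₀)
    (hℓ₀ : ℓ₀ ≤ (2 - δ) * (r * N)) (hℓ' : ℓ ≤ 2 * √(r ^ 2 * (N - v : ℕ) * N)) :
    c + ℓ ≤ (2 - δ ^ 2 / 16) * (r * N) + r * w := by
  have hN' : (0 : ℝ) < N := by exact_mod_cast hN
  have hvN : (v : ℝ) ≤ N := by exact_mod_cast hv
  set u : ℝ := v / N with hu
  have hv' : (v : ℝ) = u * N := by rw [hu]; field_simp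
  have hs : √(r ^ 2 * (N - v : ℕ) * N) = √(1 - u) * (r * N) := by
    rw [Nat.cast_sub hv, hv', show r ^ 2 * (N - u * N) * N = (1 - u) * (r * N) ^ 2 by ring,
      Real.sqrt_mul' _ (sq_nonneg _), Real.sqrt_sq (by positivity)]
  have hmin : ℓ ≤ min (2 - δ) (2 * √(1 - u)) * (r * N) := by
    rcases min_choice (2 - δ) (2 * √(1 - u)) with h | h <;> rw [h]
    · linarith
    · rw [hs] at hℓ'; linarith
  have := mul_le_mul_of_nonneg_right (add_min_sqrt_le (u := u) (by positivity)
    ((div_le_one hN').2 hvN) hδ0 hδ1) (by positivity : 0 ≤ r * N)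
  push_cast at hc
  rw [hv'] at hc
  nlinarith

lemma subsetExp_card_inter_le {α : Type*} [DecidableEq α] {q : α → ℝ} {T A : Finset α} {a : ℝ}
    (ha : 0 ≤ a) (hA : ∀ x ∈ A, q x = a) :
    subsetExp q T (fun S => (#(S ∩ A) : ℝ)) ≤ a * #A := by
  rw [subsetExp.inter q T A (fun S => (#S : ℝ)), subsetExp.card,
    sum_congr rfl fun x hx => hA x (mem_inter.1 hx).2, sum_const, nsmul_eq_mul, mul_comm]
  gcongr
  exact inter_subset_right

/-- The left side is the exact stationary mean. The right side bounds it over `K` blocks of width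
`w` on each axis, the term `r * w` paying for the rounding of exit points. -/
lemma stationary_mean_le {r δ : ℝ} (hr0 : 0 < r) (hr1 : r ≤ 1) (hδ0 : 0 < δ) (hδ1 : δ ≤ 1)
    {N K w : ℕ} (hN : 0 < N) (hw : N < w * K)
    (hsmall : subsetExp (fun _ => r ^ 2) (Ioc 0 N ×ˢ Ioc 0 N) (fun S => (chainLength S : ℝ)) ≤
      (2 - δ) * (r * N)) :
    2 * (r / (1 + r)) * N ≤ ((2 - δ ^ 2 / 16) * (r * N) + r * w) +
      2 * K * √((2 - δ ^ 2 / 16) * (r * N) + r * w) := by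
  set a := r / (1 + r) with ha
  set m := (2 - δ ^ 2 / 16) * (r * N) + r * w with hm
  have hN' : (0 : ℝ) < N := by exact_mod_cast hN
  have hw0 : 0 < w := Nat.pos_of_ne_zero (by rintro rfl; simp at hw)
  have ha1 : 0 ≤ a ∧ a ≤ 1 := odds_mem_Icc hr0.le
  have har : a ≤ r := odds_le hr0.le
  have hp : 0 ≤ r ^ 2 ∧ r ^ 2 ≤ 1 := ⟨by positivity, by nlinarith⟩
  have hq := stationaryProb_mem_Icc ha1 ha1 hp (range (N + 1) ×ˢ range (N + 1))
  have hm0 : 0 < m := by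
    have : 0 < (2 - δ ^ 2 / 16) * (r * N) := mul_pos (by nlinarith) (by positivity)
    positivity
  have hab : a * a = (1 - a) * (1 - a) * r ^ 2 := by
    rw [sq]; exact odds_mul hr0.le hr0.le
  have hmean := subsetExp_lastPassage hab N N
  -- The Boolean selects the axis. `A` runs to the end of the block and `B` begins at its start, so
  -- the pair dominates every exit point in the block.
  let A : ℕ × Bool → Finset (ℕ × ℕ) := fun j =>
    if j.2 then Ioc 0 (w * j.1 + w) ×ˢ {0} else {0} ×ˢ Ioc 0 (w * j.1 + w)
  let B : ℕ × Bool → Finset (ℕ × ℕ) := fun j =>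
    if j.2 then Ioc (w * j.1) N ×ˢ Ioc 0 N else Ioc 0 N ×ˢ Ioc (w * j.1) N
  let J : Finset (ℕ × Bool) := ((range K).filter fun j => w * j ≤ N) ×ˢ univ
  have hJ : (#J : ℝ) ≤ 2 * K := by
    have : #J ≤ K * 2 := by
      rw [card_product, card_univ, Fintype.card_bool]
      exact Nat.mul_le_mul_right _ ((card_filter_le _ _).trans (card_range K).le)
    have : (#J : ℝ) ≤ ((K * 2 : ℕ) : ℝ) := by exact_mod_cast this
    push_cast at this
    linarith
  have key := subsetExp_le_of_exists_le hq (J := J)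
    (f := fun j S => (#(S ∩ A j) + chainLength (S ∩ B j) : ℝ))
    (g := fun S => (lastPassage S N N : ℝ)) hm0 ?_ ?_ ?_
  · rw [hmean] at key
    have : (#J : ℝ) * √m ≤ 2 * K * √m := by gcongr
    linarith
  · rintro ⟨j, t⟩ _
    refine witnessed_card_add_chainLength ?_
    rw [disjoint_left]
    rintro ⟨x, y⟩
    cases t <;> simp [A, B] <;> omega
  · rintro ⟨j, t⟩ hj
    have hjN : w * j ≤ N := by simp [J] at hj; exact hj.2
    rw [subsetExp.add]
    have h1 : subsetExp (stationaryProb a a (r ^ 2)) (range (N + 1) ×ˢ range (N + 1))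
        (fun S => (#(S ∩ A (j, t)) : ℝ)) ≤ r * (w * j + w : ℕ) := by
      refine (subsetExp_card_inter_le ha1.1 (a := a) ?_).trans ?_
      · rintro ⟨x, y⟩
        cases t <;> simp [A, stationaryProb] <;> intros <;> omega
      · have : #(A (j, t)) = w * j + w := by cases t <;> simp [A]
        rw [this]
        gcongr
    have hBsub : ∀ S : Finset (ℕ × ℕ), S ∩ B (j, t) ⊆ S ∩ Ioc 0 N ×ˢ Ioc 0 N := by
      intro S
      refine inter_subset_inter_left ?_
      rintro ⟨x, y⟩
      cases t <;> simp [B] <;> omega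
    have h2 : subsetExp (stationaryProb a a (r ^ 2)) (range (N + 1) ×ˢ range (N + 1))
        (fun S => (chainLength (S ∩ B (j, t)) : ℝ)) ≤
        subsetExp (fun _ => r ^ 2) (Ioc 0 N ×ˢ Ioc 0 N) (fun S => (chainLength S : ℝ)) := by
      rw [← subsetExp_stationary_inter_box (a := a) (b := a) (le_refl N) (le_refl N)]
      exact subsetExp.mono hq fun S _ => Nat.cast_le.2 (chainLength_mono (hBsub S))
    refine exit_mean_le hr0 hδ0 hδ1 hN hjN h1 h2 hsmall ?_
    cases t
    · simp only [B, Bool.false_eq_true, if_false]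
      rw [subsetExp_stationary_inter_box (f := fun S => (chainLength S : ℝ)) (le_refl N) (le_refl N)]
      refine (subsetExp_chainLength_le_sqrt hp _ _ _ _).trans (le_of_eq ?_)
      rw [Nat.sub_zero, mul_right_comm]
    · simp only [B, if_true]
      rw [subsetExp_stationary_inter_box (f := fun S => (chainLength S : ℝ)) (le_refl N) (le_refl N)]
      refine (subsetExp_chainLength_le_sqrt hp _ _ _ _).trans (le_of_eq ?_)
      rw [Nat.sub_zero]
  · intro S _
    have hblock : ∀ z ≤ N, z / w < K ∧ w * (z / w) ≤ z ∧ z < w * (z / w) + w := fun z hz =>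
      ⟨Nat.div_lt_of_lt_mul (by omega), Nat.mul_div_le z w, by
        have := Nat.lt_mul_div_succ z hw0
        rwa [mul_add, mul_one] at this⟩
    rcases lastPassage_le_exit S N N with ⟨z, hz, h⟩ | ⟨z, hz, h⟩
    · obtain ⟨b1, b2, b3⟩ := hblock z hz
      refine ⟨(z / w, true), by simp [J, b1]; omega, ?_⟩
      simp only [A, B, if_true]
      have h1 : #(S ∩ Ioc 0 z ×ˢ {0}) ≤ #(S ∩ Ioc 0 (w * (z / w) + w) ×ˢ {0}) :=
        card_le_card (inter_subset_inter_left (product_subset_product_left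
          (Ioc_subset_Ioc_right b3.le)))
      have h2 : chainLength (S ∩ Ioc z N ×ˢ Ioc 0 N) ≤
          chainLength (S ∩ Ioc (w * (z / w)) N ×ˢ Ioc 0 N) :=
        chainLength_mono (inter_subset_inter_left (product_subset_product_left
          (Ioc_subset_Ioc_left b2)))
      exact_mod_cast h.trans (add_le_add h1 h2)
    · obtain ⟨b1, b2, b3⟩ := hblock z hz
      refine ⟨(z / w, false), by simp [J, b1]; omega, ?_⟩
      simp only [A, B, Bool.false_eq_true, if_false]
      have h1 : #(S ∩ {0} ×ˢ Ioc 0 z) ≤ #(S ∩ {0} ×ˢ Ioc 0 (w * (z / w) + w)) :=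
        card_le_card (inter_subset_inter_left (product_subset_product_right
          (Ioc_subset_Ioc_right b3.le)))
      have h2 : chainLength (S ∩ Ioc 0 N ×ˢ Ioc z N) ≤
          chainLength (S ∩ Ioc 0 N ×ˢ Ioc (w * (z / w)) N) :=
        chainLength_mono (inter_subset_inter_left (product_subset_product_right
          (Ioc_subset_Ioc_left b2)))
      exact_mod_cast h.trans (add_le_add h1 h2)

/-- Lower bound for the mean length of a longest increasing chain of random lattice points in a
square, in the sparse regime. -/
lemma exists_le_subsetExp_chainLength {δ : ℝ} (hδ0 : 0 < δ) (hδ1 : δ ≤ 1) :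
    ∃ s₀ : ℝ, 0 < s₀ ∧ ∀ (N : ℕ) (r : ℝ), 0 < r → r * s₀ ≤ 1 → s₀ ≤ r * N →
      (2 - δ) * (r * N) ≤
        subsetExp (fun _ => r ^ 2) (Ioc 0 N ×ˢ Ioc 0 N) (fun S => (chainLength S : ℝ)) := by
  set η := δ ^ 2 / 16 with hη
  have hη0 : 0 < η := by positivity
  have hη1 : η ≤ 1 := by rw [hη]; nlinarith
  obtain ⟨K, hK⟩ := exists_nat_gt (8 / η)
  have hK0 : (0 : ℝ) < K := lt_trans (by positivity) hK
  have hK0' : 0 < K := by exact_mod_cast hK0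
  have hKη : 1 / K ≤ η / 8 := by
    rw [div_lt_iff₀ hη0] at hK
    rw [div_le_div_iff₀ hK0 (by norm_num)]
    linarith
  -- The first summand forces `r ≤ η / 16` and `r * N ≥ 16 / η`; the second makes the deviation term
  -- at most `η / 2 * (r * N)`.
  refine ⟨16 / η + 4 * (8 * K / η) ^ 2, by positivity, fun N r hr0 hr hs => ?_⟩
  have hs16 : 16 / η ≤ r * N := le_trans (by linarith [show 0 ≤ 4 * (8 * K / η) ^ 2 by positivity]) hs
  have hsK : 4 * (8 * K / η) ^ 2 ≤ r * N := le_trans (by linarith [show 0 ≤ 16 / η by positivity]) hs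
  have hr16 : r ≤ η / 16 := by
    have : r * (16 / η) ≤ 1 := le_trans (by gcongr; linarith [show 0 ≤ 4 * (8 * K / η) ^ 2 by positivity]) hr
    rw [mul_div_assoc', div_le_one hη0] at this
    linarith
  by_contra! hcon
  set s := r * N with hsdef
  have hs0 : 0 < s := lt_of_lt_of_le (by positivity) hs16
  have hN : 0 < N := Nat.pos_of_ne_zero (by rintro rfl; simp [hsdef] at hs0)
  have hN' : (0 : ℝ) < N := by exact_mod_cast hN
  have h1s : 1 ≤ s * (η / 16) := by
    rw [div_le_iff₀ hη0] at hs16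
    linarith
  have hw : N < (N / K + 1) * K := by
    have := Nat.lt_mul_div_succ N hK0'
    rwa [mul_comm]
  have key := stationary_mean_le hr0 (by linarith) hδ0 hδ1 hN hw hcon.le
  rw [← hη, ← hsdef] at key
  have hwr : r * ((N / K + 1 : ℕ) : ℝ) ≤ s * (η / 8) + η / 16 := by
    have h1 : ((N / K : ℕ) : ℝ) ≤ N / K := Nat.cast_div_le
    have h2 : r * ((N / K + 1 : ℕ) : ℝ) ≤ r * (N / K + 1) := by
      push_cast
      gcongr
    have h3 : s * (1 / K) ≤ s * (η / 8) := by gcongr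
    have h4 : r * (N / K + 1) = s * (1 / K) + r := by rw [hsdef]; ring
    linarith
  set m := (2 - η) * s + r * ((N / K + 1 : ℕ) : ℝ) with hm
  have hm4 : m ≤ 4 * s := by nlinarith
  have hsq : 2 * K * √m ≤ η / 2 * s := by
    have h1 : √m ≤ √(4 * s) := Real.sqrt_le_sqrt hm4
    have h2 : √(4 * s) = 2 * √s := by
      rw [Real.sqrt_mul (by norm_num), show (4 : ℝ) = 2 ^ 2 by norm_num,
        Real.sqrt_sq (by norm_num)]
    have h3 : 2 * (8 * K / η) ≤ √s := by
      apply Real.le_sqrt_of_sq_le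
      linarith
    have h4 : √s * √s = s := Real.mul_self_sqrt hs0.le
    have h5 : 16 * K ≤ √s * η := by
      rw [mul_div_assoc', div_le_iff₀ hη0] at h3
      linarith
    have h6 : 0 < √s := Real.sqrt_pos.2 hs0
    nlinarith
  have hlow : 2 * s - 2 * r * s ≤ 2 * (r / (1 + r)) * N := by
    have : 2 * (r / (1 + r)) * N = 2 * s / (1 + r) := by rw [hsdef]; ring
    rw [this, le_div_iff₀ (by linarith)]
    nlinarith [mul_pos hs0 (mul_pos hr0 hr0)]
  -- The losses from density, rounding and deviations are about `η * s / 8`, `η * s / 8` and `η * s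
  -- / 2`, together less than the gain `η * s`.
  nlinarith

/-! ### From injective sequences to uniform permutations -/

section Permutations

/-- The graph of a finite sequence. -/
def graphFinset {k : ℕ} {γ : Type*} (g : Fin k → γ) : Finset (Fin k × γ) :=
  univ.map ⟨fun i => (i, g i), fun _ _ h => congrArg Prod.fst h⟩

lemma mem_graphFinset {k : ℕ} {γ : Type*} {g : Fin k → γ} {x : Fin k × γ} :
    x ∈ graphFinset g ↔ g x.1 = x.2 := by
  simp only [graphFinset, mem_map, mem_univ, true_and]
  exact ⟨by rintro ⟨i, rfl⟩; rfl, fun h => ⟨x.1, Prod.ext rfl h⟩⟩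

lemma lisLength_eq_chainLength {k : ℕ} (σ : Equiv.Perm (Fin k)) :
    lisLength σ = chainLength (graphFinset σ) := by
  apply le_antisymm
  · refine Finset.sup_le fun s hs => ?_
    simp only [mem_filter, mem_univ, true_and] at hs
    rw [← card_map (⟨fun i => (i, σ i), fun _ _ h => congrArg Prod.fst h⟩ : Fin k ↪ Fin k × Fin k)]
    refine IsIncreasing.card_le ?_ (map_subset_map.2 (subset_univ s))
    intro x hx y hy hxy
    obtain ⟨i, hi, rfl⟩ := mem_map.1 hx
    obtain ⟨j, hj, rfl⟩ := mem_map.1 hy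
    rcases lt_trichotomy i j with h | rfl | h
    · exact Or.inl ⟨h, hs i hi j hj h⟩
    · exact absurd rfl hxy
    · exact Or.inr ⟨h, hs j hj i hi h⟩
  · obtain ⟨C, hC, hi, hc⟩ := exists_isIncreasing (graphFinset σ)
    obtain ⟨s, _, rfl⟩ := subset_map_iff.1 hC
    rw [← hc, card_map]
    refine le_sup (f := card) (mem_filter.2 ⟨mem_univ _, fun i hi' j hj' hij => ?_⟩)
    rcases hi _ (mem_map_of_mem _ hi') _ (mem_map_of_mem _ hj')
      (fun h => hij.ne (congrArg Prod.fst h)) with h | h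
    · exact h.2
    · exact absurd h.1 hij.not_gt

lemma chainLength_graphFinset_comp {k : ℕ} {γ δ : Type*} [LinearOrder γ] [LinearOrder δ]
    (h : γ ↪o δ) (g : Fin k → γ) :
    chainLength (graphFinset (h ∘ g)) = chainLength (graphFinset g) := by
  rw [← chainLength_map (RelEmbedding.refl (· ≤ ·)) h]
  congr 1
  simp only [graphFinset, map_map]
  rfl

lemma exists_standardization {k : ℕ} {γ : Type*} [LinearOrder γ] {g : Fin k → γ}
    (hg : Function.Injective g) : ∃ (σ : Equiv.Perm (Fin k)) (h : Fin k ↪o γ), g = h ∘ σ := by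
  have hc : #(univ.image g) = k := by rw [card_image_of_injective _ hg, card_fin]
  let h := (univ.image g).orderEmbOfFin hc
  have hr : ∀ i, ∃ j, h j = g i := fun i => by
    have : g i ∈ Set.range h := by
      rw [range_orderEmbOfFin]
      simp
    exact this
  choose s hs using hr
  have hinj : Function.Injective s := fun i j hij => hg (by rw [← hs, ← hs, hij])
  exact ⟨Equiv.ofBijective s (Finite.injective_iff_bijective.1 hinj), h, funext fun i => (hs i).symm⟩

lemma sum_lisLength (n : ℕ) :
    ∑ σ : Equiv.Perm (Fin n), (lisLength σ : ℝ) = n.factorial * expectedLIS n := by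
  have : (n.factorial : ℝ) ≠ 0 := by positivity
  rw [expectedLIS]
  field_simp

/-- Only the relative order of the values matters, so `g` may be replaced by its rank permutation
`σ`; left multiplication by `σ` then reindexes the sum. -/
lemma sum_chainLength_comp_perm {k : ℕ} {γ : Type*} [LinearOrder γ] {g : Fin k → γ}
    (hg : Function.Injective g) :
    ∑ τ : Equiv.Perm (Fin k), (chainLength (graphFinset (g ∘ τ)) : ℝ) =
      k.factorial * expectedLIS k := by
  obtain ⟨σ, h, rfl⟩ := exists_standardization hg
  rw [← sum_lisLength, ← Equiv.sum_comp (Equiv.mulLeft σ) fun τ => (lisLength τ : ℝ)]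
  refine sum_congr rfl fun τ _ => ?_
  rw [Function.comp_assoc, chainLength_graphFinset_comp, lisLength_eq_chainLength]
  rfl

/-- A uniformly permuted injective sequence of length `k` has the longest increasing subsequence of a
uniform permutation of degree `k`. -/
lemma sum_chainLength_perm_comp {N k : ℕ} (g : Fin k ↪ Fin N) :
    ∑ π : Equiv.Perm (Fin N), (chainLength (graphFinset (π ∘ g)) : ℝ) =
      N.factorial * expectedLIS k := by
  have h1 : ∀ τ : Equiv.Perm (Fin k),
      ∑ π : Equiv.Perm (Fin N), (chainLength (graphFinset (π ∘ g)) : ℝ) =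
        ∑ π : Equiv.Perm (Fin N), (chainLength (graphFinset ((π ∘ g) ∘ τ)) : ℝ) := by
    intro τ
    -- Extending `τ` along `g` to all of `Fin N` turns right multiplication on `π` into
    -- precomposition of `π ∘ g` with `τ`.
    rw [← Equiv.sum_comp (Equiv.mulRight (τ.viaFintypeEmbedding g))]
    refine sum_congr rfl fun π _ => ?_
    congr 3
    funext i
    simp [Equiv.Perm.viaFintypeEmbedding_apply_image]
  have h2 : (k.factorial : ℝ) * ∑ π : Equiv.Perm (Fin N), (chainLength (graphFinset (π ∘ g)) : ℝ) =
      k.factorial * (N.factorial * expectedLIS k) := by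
    calc (k.factorial : ℝ) * ∑ π : Equiv.Perm (Fin N), (chainLength (graphFinset (π ∘ g)) : ℝ)
        = ∑ _τ : Equiv.Perm (Fin k), ∑ π : Equiv.Perm (Fin N),
            (chainLength (graphFinset (π ∘ g)) : ℝ) := by
          simp [Fintype.card_perm]
      _ = ∑ τ : Equiv.Perm (Fin k), ∑ π : Equiv.Perm (Fin N),
            (chainLength (graphFinset ((π ∘ g) ∘ τ)) : ℝ) := sum_congr rfl fun τ _ => h1 τ
      _ = ∑ π : Equiv.Perm (Fin N), ∑ τ : Equiv.Perm (Fin k),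
            (chainLength (graphFinset ((π ∘ g) ∘ τ)) : ℝ) := sum_comm
      _ = ∑ _π : Equiv.Perm (Fin N), k.factorial * expectedLIS k :=
          sum_congr rfl fun π _ => sum_chainLength_comp_perm (π.injective.comp g.injective)
      _ = _ := by
          simp [Fintype.card_perm]
          ring
  exact mul_left_cancel₀ (by positivity) h2

lemma chainLength_graphFinset_castSucc_le {n : ℕ} {γ : Type*} [LinearOrder γ] (g : Fin (n + 1) → γ) :
    chainLength (graphFinset (g ∘ Fin.castSucc)) ≤ chainLength (graphFinset g) := by
  rw [← chainLength_map Fin.castSuccOrderEmb (RelEmbedding.refl (· ≤ ·))]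
  refine chainLength_mono fun x hx => ?_
  obtain ⟨y, hy, rfl⟩ := mem_map.1 hx
  rw [mem_graphFinset] at hy ⊢
  exact hy

/-- Dropping the last entry of a uniform permutation leaves a uniform relative order and cannot
lengthen a chain. -/
lemma expectedLIS_mono : Monotone expectedLIS := by
  refine monotone_nat_of_le_succ fun n => ?_
  have h1 := sum_chainLength_perm_comp (N := n + 1) (k := n) Fin.castSuccEmb
  have h2 := sum_lisLength (n + 1)
  have h3 : ∑ π : Equiv.Perm (Fin (n + 1)), (chainLength (graphFinset (π ∘ Fin.castSuccEmb)) : ℝ) ≤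
      ∑ π : Equiv.Perm (Fin (n + 1)), (lisLength π : ℝ) := by
    refine sum_le_sum fun π _ => ?_
    rw [lisLength_eq_chainLength]
    exact Nat.cast_le.2 (chainLength_graphFinset_castSucc_le π)
  rw [h1, h2] at h3
  exact le_of_mul_le_mul_left h3 (by positivity)

lemma expectedLIS_nonneg (n : ℕ) : 0 ≤ expectedLIS n := by
  unfold expectedLIS; positivity

end Permutations

/-! ### Non-attacking configurations in a square grid -/

section Grid

variable {N : ℕ}

/-- No two points lie in the same row or column. -/
def NonAttacking (S : Finset (Fin N × Fin N)) : Prop :=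
  ∀ x ∈ S, ∀ y ∈ S, x.1 = y.1 ∨ x.2 = y.2 → x = y

/-- Permutation of the second coordinates. -/
def columnPerm (π : Equiv.Perm (Fin N)) : Fin N × Fin N ↪ Fin N × Fin N :=
  ((Equiv.refl (Fin N)).prodCongr π).toEmbedding

lemma columnPerm_apply (π : Equiv.Perm (Fin N)) (x : Fin N × Fin N) :
    columnPerm π x = (x.1, π x.2) := rfl

lemma nonAttacking_map_columnPerm (π : Equiv.Perm (Fin N)) (S : Finset (Fin N × Fin N)) :
    NonAttacking (S.map (columnPerm π)) ↔ NonAttacking S := by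
  constructor
  · intro h x hx y hy hxy
    refine (columnPerm π).injective (h _ (mem_map_of_mem _ hx) _ (mem_map_of_mem _ hy) ?_)
    simpa [columnPerm_apply] using hxy
  · intro h x hx y hy hxy
    obtain ⟨x, hx', rfl⟩ := mem_map.1 hx
    obtain ⟨y, hy', rfl⟩ := mem_map.1 hy
    rw [h x hx' y hy' (by simpa [columnPerm_apply] using hxy)]

/-- `f` lists the occupied first coordinates in increasing order; over each of them there is exactly
one point, and `g` is injective. -/
lemma NonAttacking.exists_graph {S : Finset (Fin N × Fin N)} (hS : NonAttacking S) :
    ∃ (f : Fin #S ↪o Fin N) (g : Fin #S ↪ Fin N),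
      S = (graphFinset g).map (f.toEmbedding.prodMap (.refl _)) := by
  have hc : #(S.image Prod.fst) = #S :=
    card_image_of_injOn fun x hx y hy h => hS x hx y hy (Or.inl h)
  let f := (S.image Prod.fst).orderEmbOfFin hc
  have hf : Set.range f = S.image Prod.fst := range_orderEmbOfFin _ hc
  have hex : ∀ i, ∃ y, (f i, y) ∈ S := fun i => by
    have : f i ∈ ((S.image Prod.fst : Finset _) : Set (Fin N)) := hf ▸ Set.mem_range_self i
    simpa using this
  choose g hg using hex
  have hginj : Function.Injective g := fun i j hij =>
    f.injective (congrArg Prod.fst (hS _ (hg i) _ (hg j) (Or.inr hij)))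
  refine ⟨f, ⟨g, hginj⟩, ?_⟩
  refine (eq_of_subset_of_card_le ?_ ?_).symm
  · intro x hx
    obtain ⟨⟨i, y⟩, hy, rfl⟩ := mem_map.1 hx
    rw [mem_graphFinset] at hy
    change g i = y at hy
    subst hy
    exact hg i
  · rw [card_map, graphFinset, card_map, card_fin]

lemma NonAttacking.sum_chainLength {S : Finset (Fin N × Fin N)} (hS : NonAttacking S) :
    ∑ π : Equiv.Perm (Fin N), (chainLength (S.map (columnPerm π)) : ℝ) =
      N.factorial * expectedLIS #S := by
  obtain ⟨f, g, h⟩ := hS.exists_graph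
  rw [← sum_chainLength_perm_comp g]
  refine sum_congr rfl fun π _ => ?_
  rw [← chainLength_map f (RelEmbedding.refl (· ≤ ·)) (graphFinset (π ∘ g))]
  congr 2
  conv_lhs => rw [h]
  simp only [graphFinset, map_map]
  rfl

open Classical in
/-- On non-attacking configurations the chain length may be replaced by the mean longest increasing
subsequence. -/
lemma subsetExp_nonAttacking (p : ℝ) (P : ℕ → Prop) [DecidablePred P] :
    subsetExp (fun _ => p) (univ : Finset (Fin N × Fin N))
        (fun S => if NonAttacking S ∧ P #S then (chainLength S : ℝ) else 0) =
      subsetExp (fun _ => p) (univ : Finset (Fin N × Fin N))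
        (fun S => if NonAttacking S ∧ P #S then expectedLIS #S else 0) := by
  -- The density is constant, so the law is invariant under column permutations and one may average
  -- over them.
  have h1 : ∀ π : Equiv.Perm (Fin N), subsetExp (fun _ => p) (univ : Finset (Fin N × Fin N))
        (fun S => if NonAttacking S ∧ P #S then (chainLength S : ℝ) else 0) =
      subsetExp (fun _ => p) (univ : Finset (Fin N × Fin N))
        (fun S => if NonAttacking S ∧ P #S then (chainLength (S.map (columnPerm π)) : ℝ) else 0) := by
    intro π
    have : (univ : Finset (Fin N × Fin N)) = univ.map (columnPerm π) :=
      (map_univ_equiv ((Equiv.refl (Fin N)).prodCongr π)).symm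
    conv_lhs => rw [this, subsetExp.map]
    simp only [nonAttacking_map_columnPerm, card_map]
  have h2 : (N.factorial : ℝ) * subsetExp (fun _ => p) (univ : Finset (Fin N × Fin N))
        (fun S => if NonAttacking S ∧ P #S then (chainLength S : ℝ) else 0) =
      N.factorial * subsetExp (fun _ => p) (univ : Finset (Fin N × Fin N))
        (fun S => if NonAttacking S ∧ P #S then expectedLIS #S else 0) := by
    calc
      _ = ∑ _π : Equiv.Perm (Fin N), subsetExp (fun _ => p) (univ : Finset (Fin N × Fin N))
        (fun S => if NonAttacking S ∧ P #S then (chainLength S : ℝ) else 0) := by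
          simp [Fintype.card_perm]
      _ = _ := sum_congr rfl fun π _ => h1 π
      _ = _ := (subsetExp.sum _ _ _ _).symm
      _ = _ := ?_
    rw [← subsetExp.const_mul]
    refine subsetExp.congr fun S _ => ?_
    split_ifs with h
    · exact h.1.sum_chainLength
    · simp
  exact mul_left_cancel₀ (by positivity) h2

open Classical in
-- Union bound: at most `2 * N ^ 3` ordered pairs of distinct cells share a coordinate, and each
-- pair is occupied with probability `p ^ 2`.
lemma subsetExp_not_nonAttacking_le {p : ℝ} (hp : 0 ≤ p ∧ p ≤ 1) :
    subsetExp (fun _ => p) (univ : Finset (Fin N × Fin N))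
      (fun S => if NonAttacking S then 0 else 1) ≤ 2 * N ^ 3 * p ^ 2 := by
  let Q : Finset ((Fin N × Fin N) × (Fin N × Fin N)) :=
    univ.filter fun z => z.1 ≠ z.2 ∧ (z.1.1 = z.2.1 ∨ z.1.2 = z.2.2)
  have hQ : (#Q : ℝ) ≤ 2 * N ^ 3 := by
    have : Q ⊆ (univ : Finset (Fin N × Fin N × Fin N)).image (fun t => ((t.1, t.2.1), (t.1, t.2.2))) ∪
        (univ : Finset (Fin N × Fin N × Fin N)).image (fun t => ((t.2.1, t.1), (t.2.2, t.1))) := by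
      rintro ⟨⟨a, b⟩, ⟨c, d⟩⟩ h
      simp only [Q, mem_filter, mem_univ, true_and] at h
      simp only [mem_union, mem_image, mem_univ, true_and, Prod.exists, Prod.mk.injEq]
      rcases h.2 with h | h
      · exact Or.inl ⟨a, b, d, ⟨rfl, rfl⟩, h, rfl⟩
      · exact Or.inr ⟨b, a, c, ⟨rfl, rfl⟩, rfl, h⟩
    have h2 : #Q ≤ N * (N * N) + N * (N * N) := by
      refine (card_le_card this).trans ((card_union_le _ _).trans (add_le_add ?_ ?_)) <;>
      · refine card_image_le.trans (le_of_eq ?_)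
        simp
    have h3 : (#Q : ℝ) ≤ ((N * (N * N) + N * (N * N) : ℕ) : ℝ) := by exact_mod_cast h2
    push_cast at h3
    linarith
  have h1 : subsetExp (fun _ => p) (univ : Finset (Fin N × Fin N))
      (fun S => if NonAttacking S then 0 else 1) ≤
      subsetExp (fun _ => p) (univ : Finset (Fin N × Fin N)) (fun S => ∑ z ∈ Q, if z.1 ∈ S ∧ z.2 ∈ S then 1 else 0) := by
    refine subsetExp.mono (prob_mem_Icc hp.1 hp.2) fun S _ => ?_
    have h0 : ∀ z ∈ Q, (0 : ℝ) ≤ if z.1 ∈ S ∧ z.2 ∈ S then 1 else 0 := fun z _ => by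
      split_ifs <;> norm_num
    split_ifs with h
    · exact sum_nonneg h0
    · simp only [NonAttacking, not_forall] at h
      obtain ⟨x, hx, y, hy, hxy, hne⟩ := h
      have := single_le_sum h0 (show (x, y) ∈ Q by simp [Q, hne, hxy])
      simpa [hx, hy] using this
  refine h1.trans ?_
  rw [subsetExp.sum]
  have h2 : ∀ z ∈ Q, subsetExp (fun _ => p) (univ : Finset (Fin N × Fin N))
      (fun S => if z.1 ∈ S ∧ z.2 ∈ S then 1 else 0) = p ^ 2 := fun z hz => by
    rw [subsetExp.mem_mem (mem_univ _) (mem_univ _) (by simp [Q] at hz; exact hz.1), sq]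
  rw [sum_congr rfl h2, sum_const, nsmul_eq_mul]
  gcongr

lemma subsetExp_grid (p : ℝ) : subsetExp (fun _ => p) (univ : Finset (Fin N × Fin N))
      (fun S => (chainLength S : ℝ)) =
    subsetExp (fun _ => p) (Ioc 0 N ×ˢ Ioc 0 N) (fun S => (chainLength S : ℝ)) := by
  let e : Fin N ↪o ℕ := (Fin.valOrderEmb N).trans (OrderEmbedding.addRight 1)
  have : Ioc 0 N ×ˢ Ioc 0 N =
      (univ : Finset (Fin N × Fin N)).map (e.toEmbedding.prodMap e.toEmbedding) := by
    ext ⟨x, y⟩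
    simp only [mem_product, mem_Ioc, mem_map, mem_univ, true_and, Prod.exists]
    constructor
    · rintro ⟨h1, h2⟩
      refine ⟨⟨x - 1, by omega⟩, ⟨y - 1, by omega⟩, Prod.ext ?_ ?_⟩
      · change x - 1 + 1 = x; omega
      · change y - 1 + 1 = y; omega
    · rintro ⟨a, b, h⟩
      have h1 : (a : ℕ) + 1 = x := congrArg Prod.fst h
      have h2 : (b : ℕ) + 1 = y := congrArg Prod.snd h
      omega
  rw [this, subsetExp.map]
  simp only [chainLength_map]

lemma subsetExp_grid_card (p : ℝ) : subsetExp (fun _ => p) (univ : Finset (Fin N × Fin N))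
      (fun S => (#S : ℝ)) = p * N ^ 2 := by
  rw [subsetExp.card]
  simp
  ring

open Classical in
/-- Chebyshev inequality for the number of points. -/
lemma subsetExp_card_deviation_le {p t : ℝ} (hp : 0 ≤ p ∧ p ≤ 1) (ht : 0 < t) :
    subsetExp (fun _ => p) (univ : Finset (Fin N × Fin N))
      (fun S => if t ≤ |(#S : ℝ) - p * N ^ 2| then 1 else 0) ≤ p * N ^ 2 / t ^ 2 := by
  have hv := subsetExp.variance_le_of_witnessed (T := (univ : Finset (Fin N × Fin N)))
    (prob_mem_Icc hp.1 hp.2) witnessed_card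
  rw [subsetExp_grid_card] at hv
  have : subsetExp (fun _ => p) (univ : Finset (Fin N × Fin N))
      (fun S => if t ≤ |(#S : ℝ) - p * N ^ 2| then 1 else 0) ≤
      subsetExp (fun _ => p) (univ : Finset (Fin N × Fin N)) (fun S => (t ^ 2)⁻¹ * ((#S : ℝ) - p * N ^ 2) ^ 2) := by
    refine subsetExp.mono (prob_mem_Icc hp.1 hp.2) fun S _ => ?_
    split_ifs with h
    · rw [inv_mul_eq_div, one_le_div (by positivity), ← sq_abs (_ - _)]
      gcongr
    · positivity
  rw [subsetExp.const_mul] at this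
  refine this.trans ?_
  rw [inv_mul_eq_div]
  gcongr

end Grid

/-! ### Comparison with permutations and the limit -/

open Classical in
/-- The probability that a sparse random configuration is attacking or has an atypical number of
points. -/
noncomputable def badProb (N : ℕ) (p t : ℝ) : ℝ :=
  subsetExp (fun _ => p) (univ : Finset (Fin N × Fin N))
    (fun S => if NonAttacking S ∧ |(#S : ℝ) - p * N ^ 2| < t then 0 else 1)

lemma badProb_le {N : ℕ} {p t : ℝ} (hp : 0 ≤ p ∧ p ≤ 1) (ht : 0 < t) :
    badProb N p t ≤ 2 * N ^ 3 * p ^ 2 + p * N ^ 2 / t ^ 2 := by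
  classical
  refine le_trans ?_ (add_le_add (subsetExp_not_nonAttacking_le hp)
    (subsetExp_card_deviation_le hp ht))
  rw [badProb, ← subsetExp.add]
  refine subsetExp.mono (prob_mem_Icc hp.1 hp.2) fun S _ => ?_
  by_cases h1 : NonAttacking S <;> by_cases h2 : t ≤ |(#S : ℝ) - p * N ^ 2|
  · simp [h1, h2, not_lt.2 h2]
  · simp [h1, h2, not_le.1 h2]
  · simp [h1, h2]
  · simp [h1, h2]

/-- With a mean count above `n` by the margin `t`, every good configuration has at least `n` points,
so monotonicity applies. -/
lemma expectedLIS_mul_le {N n : ℕ} {p t : ℝ} (hp : 0 ≤ p ∧ p ≤ 1) (hn : (n : ℝ) + t ≤ p * N ^ 2) :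
    expectedLIS n * (1 - badProb N p t) ≤ 2 * √(p * N ^ 2) := by
  classical
  have h0 : subsetExp (fun _ => p) (univ : Finset (Fin N × Fin N))
      (fun S => (chainLength S : ℝ)) ≤ 2 * √(p * N ^ 2) := by
    rw [subsetExp_grid]
    refine (subsetExp_chainLength_le_sqrt hp _ _ _ _).trans (le_of_eq ?_)
    rw [Nat.sub_zero, sq, mul_assoc]
  refine le_trans ?_ h0
  have h1 : subsetExp (fun _ => p) (univ : Finset (Fin N × Fin N))
        (fun S => if NonAttacking S ∧ n ≤ #S then (chainLength S : ℝ) else 0) ≤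
      subsetExp (fun _ => p) (univ : Finset (Fin N × Fin N)) (fun S => (chainLength S : ℝ)) := by
    refine subsetExp.mono (prob_mem_Icc hp.1 hp.2) fun S _ => ?_
    split_ifs
    · exact le_rfl
    · positivity
  refine le_trans ?_ h1
  rw [subsetExp_nonAttacking p fun k => n ≤ k, badProb, ← subsetExp.const (fun _ => p)
    (univ : Finset (Fin N × Fin N)) 1, ← subsetExp.sub, ← subsetExp.const_mul]
  refine subsetExp.mono (prob_mem_Icc hp.1 hp.2) fun S _ => ?_
  by_cases h : NonAttacking S ∧ |(#S : ℝ) - p * N ^ 2| < t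
  · have : n ≤ #S := by
      have := (abs_lt.1 h.2).1
      exact_mod_cast (by linarith : (n : ℝ) ≤ #S)
    rw [if_pos h, if_pos ⟨h.1, this⟩, sub_zero, mul_one]
    exact expectedLIS_mono this
  · rw [if_neg h, subsetExp.const, sub_self, mul_zero]
    split_ifs
    · exact expectedLIS_nonneg _
    · exact le_rfl

lemma chainLength_mean_le {N n : ℕ} {p t : ℝ} (hp : 0 ≤ p ∧ p ≤ 1) (hp0 : 0 < p * N ^ 2)
    (hn : p * N ^ 2 + t ≤ n) :
    subsetExp (fun _ => p) (Ioc 0 N ×ˢ Ioc 0 N) (fun S => (chainLength S : ℝ)) ≤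
      expectedLIS n + 2 * √(p * N ^ 2) * badProb N p t + √(2 * √(p * N ^ 2)) := by
  classical
  rw [← subsetExp_grid]
  set μ := subsetExp (fun _ => p) (univ : Finset (Fin N × Fin N)) (fun S => (chainLength S : ℝ))
    with hμ
  have hq := prob_mem_Icc (T := (univ : Finset (Fin N × Fin N))) hp.1 hp.2
  have h0 : μ ≤ 2 * √(p * N ^ 2) := by
    rw [hμ, subsetExp_grid]
    refine (subsetExp_chainLength_le_sqrt hp _ _ _ _).trans (le_of_eq ?_)
    rw [Nat.sub_zero, sq, mul_assoc]
  have hdev := subsetExp.abs_sub_le hq witnessed_chainLength (by positivity) h0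
  rw [← hμ] at hdev
  have hgood : subsetExp (fun _ => p) (univ : Finset (Fin N × Fin N))
      (fun S => if NonAttacking S ∧ #S ≤ n then (chainLength S : ℝ) else 0) ≤ expectedLIS n := by
    rw [subsetExp_nonAttacking p fun k => k ≤ n, ← subsetExp.const (fun _ => p)
      (univ : Finset (Fin N × Fin N)) (expectedLIS n)]
    refine subsetExp.mono hq fun S _ => ?_
    split_ifs with h
    · exact expectedLIS_mono h.2
    · exact expectedLIS_nonneg n
  -- On the bad event `μ` is bounded by its upper bound; on the good one it is at most the chain
  -- length plus the deviation. No correlation with the bad event enters.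
  have hsplit : μ ≤ subsetExp (fun _ => p) (univ : Finset (Fin N × Fin N))
      (fun S => ((if NonAttacking S ∧ #S ≤ n then (chainLength S : ℝ) else 0) +
        2 * √(p * N ^ 2) *
          (if NonAttacking S ∧ |(#S : ℝ) - p * N ^ 2| < t then 0 else 1)) +
        |(chainLength S : ℝ) - μ|) := by
    refine subsetExp.mono hq fun S _ => ?_
    have habs := le_abs_self ((chainLength S : ℝ) - μ)
    have habs0 := abs_nonneg ((chainLength S : ℝ) - μ)
    by_cases h : NonAttacking S ∧ |(#S : ℝ) - p * N ^ 2| < t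
    · have : #S ≤ n := by
        have := (abs_lt.1 h.2).2
        exact_mod_cast (by linarith : (#S : ℝ) ≤ n)
      rw [if_pos h, if_pos ⟨h.1, this⟩]
      linarith
    · rw [if_neg h]
      have : (0 : ℝ) ≤ if NonAttacking S ∧ #S ≤ n then (chainLength S : ℝ) else 0 := by
        split_ifs <;> positivity
      linarith
  rw [subsetExp.add, subsetExp.add, subsetExp.const_mul, ← badProb] at hsplit
  linarith

/-- Density of the configurations compared with permutations of degree `n`. -/
lemma sparse_density {n : ℕ} (hn : 2 ≤ n) {c : ℝ} (hc0 : 0 < c) (hc2 : c ≤ 2) :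
    (0 ≤ c * n / (n ^ 3) ^ 2 ∧ c * n / (n ^ 3) ^ 2 ≤ 1) ∧
      c * n / (n ^ 3) ^ 2 * ((n ^ 3 : ℕ) : ℝ) ^ 2 = c * n := by
  have hn' : (2 : ℝ) ≤ n := by exact_mod_cast hn
  refine ⟨⟨by positivity, ?_⟩, ?_⟩
  · rw [div_le_one (by positivity)]
    have h1 : (n : ℝ) ^ 2 ≤ (n ^ 3) ^ 2 := by
      rw [← pow_mul]
      exact pow_le_pow_right₀ (by linarith) (by norm_num)
    nlinarith
  · push_cast
    field_simp

/-- Side `n ^ 3` makes the collision bound `2 * c ^ 2 / n`, and Chebyshev with margin `θ * n`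
contributes `c / θ ^ 2 / n`. -/
lemma badProb_sparse_le {n : ℕ} (hn : 2 ≤ n) {c θ : ℝ} (hc0 : 0 < c) (hc2 : c ≤ 2) (hθ : 0 < θ) :
    badProb (n ^ 3) (c * n / (n ^ 3) ^ 2) (θ * n) ≤ (8 + 2 / θ ^ 2) / n := by
  have hn' : (2 : ℝ) ≤ n := by exact_mod_cast hn
  obtain ⟨h1, h2⟩ := sparse_density hn hc0 hc2
  refine (badProb_le h1 (by positivity)).trans ?_
  rw [h2, add_div]
  refine add_le_add ?_ ?_
  · have : 2 * ((n ^ 3 : ℕ) : ℝ) ^ 3 * (c * n / (n ^ 3) ^ 2) ^ 2 = 2 * c ^ 2 / n := by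
      push_cast
      field_simp
    rw [this]
    gcongr
    nlinarith
  · have : c * n / (θ * n) ^ 2 = c / θ ^ 2 / n := by field_simp
    rw [this]
    gcongr

lemma expectedLIS_div_sqrt_mul_le {n : ℕ} (hn : 2 ≤ n) {θ : ℝ} (hθ0 : 0 < θ) (hθ1 : θ ≤ 1) :
    expectedLIS n / √n * (1 - (8 + 2 / θ ^ 2) / n) ≤ 2 + θ := by
  have hn' : (2 : ℝ) ≤ n := by exact_mod_cast hn
  have hs : 0 < √(n : ℝ) := Real.sqrt_pos.2 (by linarith)
  obtain ⟨h1, h2⟩ := sparse_density hn (show 0 < 1 + θ by linarith) (by linarith)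
  have h3 := expectedLIS_mul_le (n := n) (t := θ * n) h1 (by rw [h2]; linarith)
  have h4 := badProb_sparse_le hn (show 0 < 1 + θ by linarith) (by linarith) hθ0
  rw [h2, Real.sqrt_mul (by linarith)] at h3
  have h5 : √(1 + θ) ≤ 1 + θ / 2 := by
    rw [Real.sqrt_le_left (by linarith)]
    nlinarith
  rw [div_mul_eq_mul_div, div_le_iff₀ hs]
  have h6 := mul_le_mul_of_nonneg_left (sub_le_sub_left h4 1) (expectedLIS_nonneg n)
  have h7 := mul_le_mul_of_nonneg_right h5 hs.le
  linarith

lemma le_expectedLIS_div_sqrt {δ : ℝ} (hδ0 : 0 < δ) (hδ1 : δ ≤ 1 / 2) :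
    ∀ᶠ n : ℕ in Filter.atTop,
      2 - 3 * δ - 2 * ((8 + 2 / δ ^ 2) / n) - √(2 / √n) ≤ expectedLIS n / √n := by
  obtain ⟨s₀, hs0, h⟩ := exists_le_subsetExp_chainLength hδ0 (by linarith)
  -- Since `1 - δ ≥ 1 / 2`, this threshold gives `s₀ ^ 2 ≤ (1 - δ) * n` and `s₀ ≤ n`, as the sparse
  -- lower bound requires.
  filter_upwards [Filter.eventually_ge_atTop 2,
    tendsto_natCast_atTop_atTop.eventually_ge_atTop (s₀ + 2 * s₀ ^ 2)] with n hn hns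
  have hn' : (2 : ℝ) ≤ n := by exact_mod_cast hn
  have hs : 0 < √(n : ℝ) := Real.sqrt_pos.2 (by linarith)
  have hc0 : 0 < 1 - δ := by linarith
  obtain ⟨h1, h2⟩ := sparse_density hn hc0 (by linarith)
  have hX : √((1 - δ) * n) ≤ √n := Real.sqrt_le_sqrt (by nlinarith)
  set X := √((1 - δ) * n) with hXdef
  have hX0 : 0 < X := Real.sqrt_pos.2 (by positivity)
  have hXX : X ^ 2 = (1 - δ) * n := Real.sq_sqrt (by positivity)
  have hr2 : (X / n ^ 3) ^ 2 = (1 - δ) * n / (n ^ 3) ^ 2 := by rw [div_pow, hXX]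
  have hrN : X / n ^ 3 * ((n ^ 3 : ℕ) : ℝ) = X := by push_cast; field_simp
  have hXn : X ≤ n := by
    rw [hXdef, Real.sqrt_le_left (by linarith)]
    nlinarith
  have hlow := h (n ^ 3) (X / n ^ 3) (by positivity) ?_ ?_
  · rw [hr2, hrN] at hlow
    have hup := chainLength_mean_le (n := n) (t := δ * n) h1 (by rw [h2]; positivity)
      (by rw [h2]; linarith)
    have hbad := badProb_sparse_le hn hc0 (by linarith) hδ0
    rw [h2, ← hXdef] at hup
    have hD : 0 ≤ (8 + 2 / δ ^ 2) / n := by positivity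
    set D := (8 + 2 / δ ^ 2) / n
    have hb : 2 * X * badProb (n ^ 3) ((1 - δ) * n / (n ^ 3) ^ 2) (δ * n) ≤ 2 * √n * D := by
      calc _ ≤ 2 * X * D := by gcongr
        _ ≤ _ := by gcongr
    have hv : √(2 * X) ≤ √(2 / √n) * √n := by
      rw [← Real.sqrt_mul_self hs.le, ← Real.sqrt_mul (by positivity), Real.sqrt_mul_self hs.le]
      apply Real.sqrt_le_sqrt
      have : 2 / √(n : ℝ) * (√n * √n) = 2 * √n := by field_simp
      rw [this]
      linarith
    have hX1 : (1 - δ) * √n ≤ X := by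
      apply Real.le_sqrt_of_sq_le
      rw [mul_pow, Real.sq_sqrt (by linarith)]
      nlinarith
    rw [le_div_iff₀ hs]
    have hmul : (2 - δ) * ((1 - δ) * √n) ≤ (2 - δ) * X := by
      gcongr
      linarith
    -- The main term is `(2 - δ) * (1 - δ) ≥ 2 - 3 * δ`.
    nlinarith [mul_pos (mul_pos hδ0 hδ0) hs]
  · rw [div_mul_eq_mul_div, div_le_one (by positivity)]
    have : s₀ ≤ n := by nlinarith
    calc X * s₀ ≤ n * n := by gcongr
      _ ≤ n ^ 3 := by nlinarith
  · rw [hrN]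
    apply Real.le_sqrt_of_sq_le
    nlinarith

theorem mainTheorem1 :
    Filter.Tendsto (fun n : ℕ => expectedLIS n / Real.sqrt (n : ℝ)) Filter.atTop (nhds 2) := by
  have hinv : ∀ C : ℝ, Filter.Tendsto (fun n : ℕ => C / (n : ℝ)) Filter.atTop (nhds 0) :=
    fun C => tendsto_const_div_atTop_nhds_zero_nat C
  refine tendsto_order.2 ⟨fun c hc => ?_, fun c hc => ?_⟩
  · set δ := min (1 / 2) ((2 - c) / 4) with hδ
    have hδ0 : 0 < δ := lt_min (by norm_num) (by linarith)
    have hδ1 : δ ≤ 1 / 2 := min_le_left _ _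
    have hδ2 : δ ≤ (2 - c) / 4 := min_le_right _ _
    have hsqrt : Filter.Tendsto (fun n : ℕ => √(2 / √(n : ℝ))) Filter.atTop (nhds 0) := by
      have h1 : Filter.Tendsto (fun n : ℕ => √(n : ℝ)) Filter.atTop Filter.atTop :=
        Real.tendsto_sqrt_atTop.comp tendsto_natCast_atTop_atTop
      simpa using (h1.const_div_atTop 2).sqrt
    have hlim := (((hinv (8 + 2 / δ ^ 2)).const_mul 2).const_sub (2 - 3 * δ)).sub hsqrt
    filter_upwards [le_expectedLIS_div_sqrt hδ0 hδ1,
      hlim.eventually (lt_mem_nhds (show c < 2 - 3 * δ - 2 * 0 - 0 by linarith))] with n h1 h2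
    exact h2.trans_le h1
  · set θ := min 1 ((c - 2) / 2) with hθ
    have hθ0 : 0 < θ := lt_min one_pos (by linarith)
    have hθ1 : θ ≤ 1 := min_le_left _ _
    have hθ2 : θ ≤ (c - 2) / 2 := min_le_right _ _
    have hlim := ((hinv (8 + 2 / θ ^ 2)).const_sub 1).const_mul c
    filter_upwards [Filter.eventually_ge_atTop 2,
      hlim.eventually (lt_mem_nhds (show 2 + θ < c * (1 - 0) by linarith)),
      ((hinv (8 + 2 / θ ^ 2)).const_sub 1).eventually
        (lt_mem_nhds (show (0 : ℝ) < 1 - 0 by norm_num))] with n hn h2 h3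
    exact lt_of_mul_lt_mul_right ((expectedLIS_div_sqrt_mul_le hn hθ0 hθ1).trans_lt h2) h3.le
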